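/- Let $d\ge 1$ and let $\Omega\subset\mathbb R^d$ be a non-empty bounded open set (for instance a bounded polyhedral Lipschitz domain) that has a regular (conforming, simplicial) triangulation $\mathcal T_H$, and let $\mathcal T_h$ be a second regular triangulation of $\Omega$ that refines $\mathcal T_H$. Let $\gamma>0$ be a shape regularity parameter of both triangulations: every simplex $T$ contains a ball of radius $\gamma\,\mathrm{diam}(T)$. Put $H_T=\mathrm{diam}(T)$ for $T\in\mathcal T_H$ and $\|H\|_\infty=\max_{T\in\mathcal T_H}H_T$. Write $\langle\cdot,\cdot\rangle$ for the inner product of $L^2(\Omega)$, $|v|_{H^1}=\|\nabla v\|_{L^2(\Omega)}$, and $V_H\subset V_h$ for the spaces of functions in $C^0(\overline\Omega)\cap H^1_0(\Omega)$ that are affine on each simplex of $\mathcal T_H$, respectively $\mathcal T_h$. Let $C_p>0$ satisfy $\|v\|_{L^2(\Omega)}\le C_p|v|_{H^1}$ for all $v\in H^1_0(\Omega)$. Assume: * (A1) $A$ is a measurable function on $\Omega$ with values in the symmetric $d\times d$ matrices, and $\alpha|\zeta|^2\le A(x)\zeta\cdot\zeta\le\beta|\zeta|^2$ for a.e. $x\in\Omega$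 and all $\zeta\in\mathbb R^d$, where $0<\alpha\le\beta<\infty$. * (A2) $F:\Omega\times\mathbb R\times\mathbb R^d\to\mathbb R$ is measurable and there are $L_1,L_2>0$ such that for a.e. $x$ and all arguments $|F(x,\xi_1,\zeta)-F(x,\xi_2,\zeta)|\le L_1|\xi_1-\xi_2|$, $|F(x,\xi,\zeta_1)-F(x,\xi,\zeta_2)|\le L_2|\zeta_1-\zeta_2|$ and $F(x,0,0)=0$. * (A3) There is $c_0>0$ such that $\langle B(u)-B(v),u-v\rangle\ge c_0|u-v|_{H^1}^2$ for all $u,v\in H^1_0(\Omega)$, where $\langle B(u),w\rangle:=\langle A\nabla u,\nabla w\rangle+\langle F(\cdot,u,\nabla u),w\rangle$. * (A4), (A5) $\mathfrak I_H:V_h\to V_H$ is linear, and its restriction to $V_H$ is an isomorphism of $V_H$. * (A6) For all $v\in V_h$ and $T\in\mathcal T_H$: $H_T^{-1}\|v-\mathfrak I_Hv\|_{L^2(T)}+\|\nabla(v-\mathfrak I_Hv)\|_{L^2(T)}\le C_{\mathfrak I}\|\nabla v\|_{L^2(\omega_T)}$, where $\omega_T$ is the union of the closed simplices of $\mathcal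 T_H$ that meet $T$. * (A7) For every $v_H\in V_H$ there is $v_h\in V_h$ with $\mathfrak I_Hv_h=v_H$, $|v_h|_{H^1}\le C'_{\mathfrak I}|v_H|_{H^1}$ and $\operatorname{supp}v_h\subset\operatorname{supp}v_H$. Let $V_h^f=\ker\mathfrak I_H$ and let $P$ be the orthogonal projection onto $V_h^f$ with respect to $\langle A\nabla\cdot,\nabla\cdot\rangle$. Put $V^{ms}_{H,h}=\{v-Pv: v\in V_H\}$. For an interior vertex $z$ of $\mathcal T_H$ let $\lambda_z\in V_H$ be its nodal basis function, let $\omega_{z,1}$ be the union of the closed simplices of $\mathcal T_H$ containing $z$, and let $\omega_{z,k}$ be the union of those meeting $\omega_{z,k-1}$, for $k\ge2$. Let $\phi_{z,k}\in V_h^f(\omega_{z,k}):=\{v\in V_h^f: v=0\text{ on }\Omega\setminus\omega_{z,k}\}$ solve $\langle A\nabla\phi_{z,k},\nabla w\rangle=\langle A\nabla\lambda_z,\nabla w\rangle$ for all $w\in V_h^f(\omega_{z,k})$, and put $V^{ms,k}_{H,h}=\operatorname{span}\{\lambda_z-\phi_{z,k}\}$, where $z$ runs over the interior vertices. Let $g\in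 L^2(\Omega)$ and $k\ge1$, and let $u_h\in V_h$, $u^{ms}_{H,h}\in V^{ms}_{H,h}$ and $u^{ms,k}_{H,h}\in V^{ms,k}_{H,h}$ be the Galerkin solutions in these three spaces, i.e. for $S=V_h$, $V^{ms}_{H,h}$, $V^{ms,k}_{H,h}$ the respective $u\in S$ satisfies $\langle B(u),v\rangle=\langle g,v\rangle$ for all $v\in S$. Then the minimum below is attained and $$|u_h-u^{ms,k}_{H,h}|_{H^1}\le C\Big(\tilde C_2\,\|g\|_{L^2(\Omega)}\|H\|_\infty+\tilde C_3\min_{v\in V^{ms,k}_{H,h}}\|A^{1/2}\nabla(u^{ms}_{H,h}-v)\|_{L^2(\Omega)}\Big),$$ where $C>0$ depends only on $d$, $\gamma$, $C_{\mathfrak I}$ and $C'_{\mathfrak I}$, and $$\tilde C_1=\big(\beta+(L_1C_p+L_2)C_p\big)\,\frac{\beta+\|H\|_\infty(L_1C_p+L_2)}{c_0^2\,\alpha},\qquad \tilde C_2=\tilde C_1+\tilde C_1\,C_p\,\frac{L_1C_p+L_2}{c_0},\qquad \tilde C_3=\frac{\beta^{1/2}+\alpha^{-1/2}(L_1C_p+L_2)C_p}{c_0}.$$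 -/

import Mathlib

open MeasureTheory Set Filter Topology
open scoped ContDiff MatrixOrder

noncomputable section

namespace LOD

/-- Euclidean space `ℝ^d`. -/
abbrev E (d : ℕ) : Type := EuclideanSpace ℝ (Fin d)

variable {d : ℕ}

/-- Pairs (function, gradient) in `L²(Ω) × L²(Ω; ℝ^d)`: the ambient space of `H¹(Ω)`, in which a
Sobolev function `u` is represented by `(u, ∇u)`. -/
abbrev L2Pair (Ω : Set (E d)) : Type :=
  Lp ℝ 2 (volume.restrict Ω) × Lp (E d) 2 (volume.restrict Ω)

/-! ### The Sobolev space with zero boundary values -/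

/-- `φ ∈ C_c^∞(Ω)`. -/
def IsTestFunction (Ω : Set (E d)) (φ : E d → ℝ) : Prop :=
  ContDiff ℝ ∞ φ ∧ HasCompactSupport φ ∧ tsupport φ ⊆ Ω

theorem gradient_add' {φ ψ : E d → ℝ} (hφ : ContDiff ℝ ∞ φ) (hψ : ContDiff ℝ ∞ ψ) (x : E d) :
    gradient (φ + ψ) x = gradient φ x + gradient ψ x := by
  have h1 : DifferentiableAt ℝ φ x := hφ.differentiable (by simp) x
  have h2 : DifferentiableAt ℝ ψ x := hψ.differentiable (by simp) x
  simp [gradient, fderiv_add h1 h2]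

theorem gradient_smul' {φ : E d → ℝ} (hφ : ContDiff ℝ ∞ φ) (c : ℝ) (x : E d) :
    gradient (c • φ) x = c • gradient φ x := by
  have h1 : DifferentiableAt ℝ φ x := hφ.differentiable (by simp) x
  simp [gradient, fderiv_const_smul h1 c]

/-- The pairs `(φ, ∇φ)` with `φ ∈ C_c^∞(Ω)`. -/
def testPairs (Ω : Set (E d)) : Submodule ℝ (L2Pair Ω) where
  carrier := {u | ∃ φ : E d → ℝ, IsTestFunction Ω φ ∧
    u.1 =ᵐ[volume.restrict Ω] φ ∧ u.2 =ᵐ[volume.restrict Ω] gradient φ}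
  zero_mem' := by
    refine ⟨0, ⟨contDiff_const, HasCompactSupport.zero, by simp [tsupport]⟩, ?_, ?_⟩
    · exact Lp.coeFn_zero _ _ _
    · filter_upwards [Lp.coeFn_zero (E d) 2 (volume.restrict Ω)] with x hx
      have : gradient (0 : E d → ℝ) x = 0 := by simp [gradient]
      rw [this]
      exact hx
  add_mem' := by
    rintro u v ⟨φ, ⟨hφ, hφc, hφs⟩, h1, h2⟩ ⟨ψ, ⟨hψ, hψc, hψs⟩, h3, h4⟩
    refine ⟨φ + ψ, ⟨hφ.add hψ, hφc.add hψc, (tsupport_add φ ψ).trans (union_subset hφs hψs)⟩,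
      ?_, ?_⟩
    · filter_upwards [Lp.coeFn_add u.1 v.1, h1, h3] with x hx e1 e2
      simp only [Prod.fst_add, hx, Pi.add_apply, e1, e2]
    · filter_upwards [Lp.coeFn_add u.2 v.2, h2, h4] with x hx e1 e2
      simp only [Prod.snd_add, hx, Pi.add_apply, e1, e2, gradient_add' hφ hψ]
  smul_mem' := by
    rintro c u ⟨φ, ⟨hφ, hφc, hφs⟩, h1, h2⟩
    refine ⟨c • φ, ⟨hφ.const_smul c, hφc.smul_left (f := fun _ => c),
      (tsupport_smul_subset_right (fun _ => c) φ).trans hφs⟩, ?_, ?_⟩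
    · filter_upwards [Lp.coeFn_smul c u.1, h1] with x hx e1
      simp only [Prod.smul_fst, hx, Pi.smul_apply, e1]
    · filter_upwards [Lp.coeFn_smul c u.2, h2] with x hx e1
      simp only [Prod.smul_snd, hx, Pi.smul_apply, e1, gradient_smul' hφ]

/-- `H¹₀(Ω)`: the closure of `C_c^∞(Ω)` in the `H¹`-norm; an element `u` is the pair
(function `u.1`, weak gradient `u.2`). In particular `‖u.2‖` is the seminorm `|u|_{H¹(Ω)}`. -/
def H10 (Ω : Set (E d)) : Submodule ℝ (L2Pair Ω) := (testPairs Ω).topologicalClosure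

/-- `C` is a constant in the Poincaré-Friedrichs inequality on `H¹₀(Ω)`. -/
def IsPoincareConstant (Ω : Set (E d)) (C : ℝ) : Prop :=
  0 < C ∧ ∀ u ∈ H10 Ω, ‖u.1‖ ≤ C * ‖u.2‖

/-- `‖f‖_{L²(S ∩ Ω)}`. -/
def l2On (Ω S : Set (E d)) {W : Type*} [NormedAddCommGroup W] (f : E d → W) : ℝ :=
  Real.sqrt (∫ x in S, ‖f x‖ ^ 2 ∂(volume.restrict Ω))

/-- The support of an almost everywhere defined function on `Ω`. -/
def aeSupport (Ω : Set (E d)) (f : E d → ℝ) : Set (E d) :=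
  {x | ∀ U ∈ 𝓝 x, ¬ f =ᵐ[(volume.restrict Ω).restrict U] 0}

/-! ### Triangulations -/

/-- The cells of a simplicial complex: the vertex sets of its closed `d`-simplices. -/
def cells (K : Geometry.SimplicialComplex ℝ (E d)) : Set (Finset (E d)) :=
  {s | s ∈ K.faces ∧ s.card = d + 1}

/-- The closed simplex with the given vertices. -/
abbrev hull (s : Finset (E d)) : Set (E d) := convexHull ℝ (s : Set (E d))

/-- `K` is a regular (conforming, finite, simplicial) triangulation of `Ω`. Conformity is part of
`Geometry.SimplicialComplex`. -/
structure IsTriangulation (K : Geometry.SimplicialComplex ℝ (E d)) (Ω : Set (E d)) : Prop where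
  finite : K.faces.Finite
  pure : ∀ s ∈ K.faces, ∃ t ∈ cells K, s ⊆ t
  space_eq : K.space = closure Ω

/-- Shape regularity with parameter `γ`: each simplex `T` contains a ball of radius
`γ * diam T`. -/
def ShapeRegular (K : Geometry.SimplicialComplex ℝ (E d)) (γ : ℝ) : Prop :=
  ∀ s ∈ cells K, ∃ c, Metric.closedBall c (γ * Metric.diam (hull s)) ⊆ hull s

/-- `Kh` is a refinement of `KH`. -/
def Refines (Kh KH : Geometry.SimplicialComplex ℝ (E d)) : Prop :=
  ∀ s ∈ cells Kh, ∃ t ∈ cells KH, hull s ⊆ hull t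

/-- `‖H‖_{L^∞(Ω)}` for the piecewise constant mesh size function `H|_T = diam T`: the largest
diameter of a cell. -/
def maxMeshSize (K : Geometry.SimplicialComplex ℝ (E d)) : ℝ :=
  ⨆ s : cells K, Metric.diam (hull s.1)

/-- The union of all cells that meet `S`. For a cell `T` and `S = T` this is `ω_T`. -/
def neighbourhood (K : Geometry.SimplicialComplex ℝ (E d)) (S : Set (E d)) : Set (E d) :=
  ⋃ s ∈ {s | s ∈ cells K ∧ (hull s ∩ S).Nonempty}, hull s

/-- The nodal patches `ω_{z,k}` of `k ≥ 1` layers around the node `z` (by convention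
`ω_{z,0} = {z}`, so that `ω_{z,1}` is the union of the cells that contain `z`). -/
def patch (K : Geometry.SimplicialComplex ℝ (E d)) (z : E d) : ℕ → Set (E d)
  | 0 => {z}
  | k + 1 => neighbourhood K (patch K z k)

/-- The interior vertices of the triangulation. -/
def nodes (K : Geometry.SimplicialComplex ℝ (E d)) (Ω : Set (E d)) : Set (E d) :=
  K.vertices ∩ Ω

/-! ### Finite element spaces -/

/-- `v` is continuous on the closure of `Ω` and affine on every cell. -/
def IsP1 (K : Geometry.SimplicialComplex ℝ (E d)) (Ω : Set (E d)) (v : E d → ℝ) : Prop :=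
  ContinuousOn v (closure Ω) ∧ ∀ s ∈ cells K, ∃ a : E d →ᵃ[ℝ] ℝ, EqOn v a (hull s)

/-- The conforming `P₁` space: the elements of `C⁰(closure Ω) ∩ H¹₀(Ω)` that are affine on every
cell. -/
def femSpace (K : Geometry.SimplicialComplex ℝ (E d)) (Ω : Set (E d)) :
    Submodule ℝ (L2Pair Ω) where
  carrier := {u | u ∈ H10 Ω ∧ ∃ v, IsP1 K Ω v ∧ u.1 =ᵐ[volume.restrict Ω] v}
  zero_mem' := ⟨zero_mem _, 0, ⟨continuousOn_const, fun _ _ => ⟨0, fun _ _ => rfl⟩⟩,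
    Lp.coeFn_zero _ _ _⟩
  add_mem' := by
    rintro u w ⟨hu, v, ⟨hvc, hva⟩, h1⟩ ⟨hw, v', ⟨hvc', hva'⟩, h2⟩
    refine ⟨add_mem hu hw, v + v', ⟨hvc.add hvc', fun s hs => ?_⟩, ?_⟩
    · obtain ⟨a, ha⟩ := hva s hs
      obtain ⟨a', ha'⟩ := hva' s hs
      exact ⟨a + a', fun x hx => by simp [ha hx, ha' hx]⟩
    · filter_upwards [Lp.coeFn_add u.1 w.1, h1, h2] with x hx e1 e2
      simp only [Prod.fst_add, hx, Pi.add_apply, e1, e2]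
  smul_mem' := by
    rintro c u ⟨hu, v, ⟨hvc, hva⟩, h1⟩
    refine ⟨Submodule.smul_mem _ c hu, c • v, ⟨hvc.const_smul c, fun s hs => ?_⟩, ?_⟩
    · obtain ⟨a, ha⟩ := hva s hs
      exact ⟨c • a, fun x hx => by simp [ha hx]⟩
    · filter_upwards [Lp.coeFn_smul c u.1, h1] with x hx e1
      simp only [Prod.smul_fst, hx, Pi.smul_apply, e1]

theorem femSpace_mono {Kh KH : Geometry.SimplicialComplex ℝ (E d)} (href : Refines Kh KH)
    (Ω : Set (E d)) : femSpace KH Ω ≤ femSpace Kh Ω := by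
  rintro u ⟨hu, v, ⟨hvc, hva⟩, h1⟩
  refine ⟨hu, v, ⟨hvc, fun s hs => ?_⟩, h1⟩
  obtain ⟨t, ht, hst⟩ := href s hs
  obtain ⟨a, ha⟩ := hva t ht
  exact ⟨a, fun x hx => ha (hst hx)⟩

/-- `b` is the nodal (tent) basis function of the interior vertex `z`. -/
def IsNodalBasisFunction (K : Geometry.SimplicialComplex ℝ (E d)) (Ω : Set (E d)) (z : E d)
    (b : L2Pair Ω) : Prop :=
  b ∈ femSpace K Ω ∧ ∃ v, IsP1 K Ω v ∧ b.1 =ᵐ[volume.restrict Ω] v ∧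
    v z = 1 ∧ ∀ z' ∈ nodes K Ω, z' ≠ z → v z' = 0

/-! ### The semi-linear problem -/

/-- Matrix times vector in Euclidean space. -/
abbrev mulE (M : Matrix (Fin d) (Fin d) ℝ) (ζ : E d) : E d :=
  Matrix.toEuclideanCLM (n := Fin d) (𝕜 := ℝ) M ζ

/-- The coefficient `A` is bounded, symmetric and uniformly elliptic (A1), with `α` and `β` any lower and upper spectral bounds. -/
structure IsCoefficient (Ω : Set (E d)) (A : E d → Matrix (Fin d) (Fin d) ℝ) (α β : ℝ) :
    Prop where
  measurable : ∀ i j, AEMeasurable (fun x => A x i j) (volume.restrict Ω)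
  symm : ∀ᵐ x ∂(volume.restrict Ω), (A x).IsSymm
  pos : 0 < α
  lower : ∀ᵐ x ∂(volume.restrict Ω), ∀ ζ : E d, α * ‖ζ‖ ^ 2 ≤ inner ℝ (mulE (A x) ζ) ζ
  upper : ∀ᵐ x ∂(volume.restrict Ω), ∀ ζ : E d, inner ℝ (mulE (A x) ζ) ζ ≤ β * ‖ζ‖ ^ 2

/-- Assumption (A2) on the measurable nonlinearity `F(x, ξ, ζ)`. -/
structure IsNonlinearity (Ω : Set (E d)) (F : E d → ℝ → E d → ℝ) (L₁ L₂ : ℝ) : Prop where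
  measurable : Measurable (fun p : E d × ℝ × E d => F p.1 p.2.1 p.2.2)
  pos₁ : 0 < L₁
  pos₂ : 0 < L₂
  lipschitz₁ : ∀ᵐ x ∂(volume.restrict Ω), ∀ (ζ : E d) (ξ₁ ξ₂ : ℝ),
    |F x ξ₁ ζ - F x ξ₂ ζ| ≤ L₁ * |ξ₁ - ξ₂|
  lipschitz₂ : ∀ᵐ x ∂(volume.restrict Ω), ∀ (ξ : ℝ) (ζ₁ ζ₂ : E d),
    |F x ξ ζ₁ - F x ξ ζ₂| ≤ L₂ * ‖ζ₁ - ζ₂‖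
  zero : ∀ᵐ x ∂(volume.restrict Ω), F x 0 0 = 0

/-- `⟨A∇u, ∇w⟩`. -/
def aForm {Ω : Set (E d)} (A : E d → Matrix (Fin d) (Fin d) ℝ) (u w : L2Pair Ω) : ℝ :=
  ∫ x, inner ℝ (mulE (A x) (u.2 x)) (w.2 x) ∂(volume.restrict Ω)

/-- `⟨B(u), w⟩ = ⟨A∇u, ∇w⟩ + ⟨F(·, u, ∇u), w⟩`. -/
def bForm {Ω : Set (E d)} (A : E d → Matrix (Fin d) (Fin d) ℝ) (F : E d → ℝ → E d → ℝ)
    (u w : L2Pair Ω) : ℝ :=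
  aForm A u w + ∫ x, F x (u.1 x) (u.2 x) * w.1 x ∂(volume.restrict Ω)

/-- Assumption (A3): `B` is strongly monotone on `H¹₀(Ω)` with constant `c₀`. -/
def StronglyMonotone (Ω : Set (E d)) (A : E d → Matrix (Fin d) (Fin d) ℝ)
    (F : E d → ℝ → E d → ℝ) (c₀ : ℝ) : Prop :=
  0 < c₀ ∧ ∀ u ∈ H10 Ω, ∀ v ∈ H10 Ω,
    c₀ * ‖(u - v).2‖ ^ 2 ≤ bForm A F u (u - v) - bForm A F v (u - v)

/-- `‖A^{1/2} ∇u‖_{L²(Ω)}`. -/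
def energyNorm {Ω : Set (E d)} (A : E d → Matrix (Fin d) (Fin d) ℝ) (u : L2Pair Ω) : ℝ :=
  Real.sqrt (∫ x, ‖mulE (CFC.sqrt (A x)) (u.2 x)‖ ^ 2 ∂(volume.restrict Ω))

/-- `u` is the Galerkin approximation in the subspace `S`: `u ∈ S` and
`⟨A∇u, ∇v⟩ + ⟨F(·, u, ∇u), v⟩ = ⟨g, v⟩` for all `v ∈ S`. -/
def IsGalerkinSolution {Ω : Set (E d)} (A : E d → Matrix (Fin d) (Fin d) ℝ)
    (F : E d → ℝ → E d → ℝ) (g : Lp ℝ 2 (volume.restrict Ω)) (S : Submodule ℝ (L2Pair Ω))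
    (u : L2Pair Ω) : Prop :=
  u ∈ S ∧ ∀ v ∈ S, bForm A F u v = ∫ x, g x * v.1 x ∂(volume.restrict Ω)

/-! ### Quasi-interpolation and the multiscale spaces -/

/-- Assumptions (A5)-(A7) on the quasi-interpolation operator `I : V_h → V_H`; linearity (A4) is
part of the type of `I`. -/
structure IsQuasiInterpolation {Kh KH : Geometry.SimplicialComplex ℝ (E d)} {Ω : Set (E d)}
    (href : Refines Kh KH) (I : femSpace Kh Ω →ₗ[ℝ] femSpace KH Ω) (CI CI' : ℝ) : Prop where
  bijective : Function.Bijective fun v : femSpace KH Ω => I ⟨v.1, femSpace_mono href Ω v.2⟩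
  approx : ∀ v : femSpace Kh Ω, ∀ s ∈ cells KH,
    (Metric.diam (hull s))⁻¹ * l2On Ω (hull s) (v.1 - (I v).1).1
      + l2On Ω (hull s) (v.1 - (I v).1).2
      ≤ CI * l2On Ω (neighbourhood KH (hull s)) v.1.2
  lift : ∀ w : femSpace KH Ω, ∃ v : femSpace Kh Ω, I v = w ∧ ‖v.1.2‖ ≤ CI' * ‖w.1.2‖ ∧
    aeSupport Ω v.1.1 ⊆ aeSupport Ω w.1.1

/-- The fine space `V_h^f`: the kernel of `I`, as a space of functions on `Ω`. -/
def fineSpace {Kh KH : Geometry.SimplicialComplex ℝ (E d)} {Ω : Set (E d)}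
    (I : femSpace Kh Ω →ₗ[ℝ] femSpace KH Ω) : Submodule ℝ (L2Pair Ω) :=
  (LinearMap.ker I).map (femSpace Kh Ω).subtype

/-- The localized fine space `V_h^f(S)`: the fine functions that vanish on `Ω \ S`. -/
def localFineSpace {Kh KH : Geometry.SimplicialComplex ℝ (E d)} {Ω : Set (E d)}
    (I : femSpace Kh Ω →ₗ[ℝ] femSpace KH Ω) (S : Set (E d)) : Set (L2Pair Ω) :=
  {v | v ∈ fineSpace I ∧ v.1 =ᵐ[(volume.restrict Ω).restrict Sᶜ] 0}

/-- `p` is the `⟨A∇·,∇·⟩`-orthogonal projection of `v` to the set (a linear subspace) `W`. -/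
def IsProjection {Ω : Set (E d)} (A : E d → Matrix (Fin d) (Fin d) ℝ) (W : Set (L2Pair Ω))
    (v p : L2Pair Ω) : Prop :=
  p ∈ W ∧ ∀ w ∈ W, aForm A p w = aForm A v w

/-- The multiscale space `V^ms_{H,h} = {v - P v | v ∈ V_H}`, where `P` is the orthogonal projection
to the fine space. -/
def msSpace {Kh KH : Geometry.SimplicialComplex ℝ (E d)} {Ω : Set (E d)}
    (A : E d → Matrix (Fin d) (Fin d) ℝ) (I : femSpace Kh Ω →ₗ[ℝ] femSpace KH Ω) :
    Submodule ℝ (L2Pair Ω) :=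
  Submodule.span ℝ {u | ∃ v ∈ femSpace KH Ω, ∃ p, IsProjection A (fineSpace I) v p ∧ u = v - p}

/-- The localized multiscale space `V^{ms,k}_{H,h}`: the span of the functions `λ_z - φ_{z,k}`, where
`z` is an interior vertex, `λ_z` its nodal basis function and `φ_{z,k}` the projection of `λ_z` to
the localized fine space on the patch `ω_{z,k}`. -/
def msSpaceLocal {Kh KH : Geometry.SimplicialComplex ℝ (E d)} {Ω : Set (E d)}
    (A : E d → Matrix (Fin d) (Fin d) ℝ) (I : femSpace Kh Ω →ₗ[ℝ] femSpace KH Ω) (k : ℕ) :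
    Submodule ℝ (L2Pair Ω) :=
  Submodule.span ℝ {u | ∃ z ∈ nodes KH Ω, ∃ b, IsNodalBasisFunction KH Ω z b ∧
    ∃ p, IsProjection A (localFineSpace I (patch KH z k)) b p ∧ u = b - p}

/-! ### The explicit constants -/

/-- `C̃₁ = (β + (L₁C_p + L₂)C_p)(β + ‖H‖(L₁C_p + L₂)) / (c₀²α)`. -/
def const₁ (α β L₁ L₂ c₀ Cp H : ℝ) : ℝ :=
  (β + (L₁ * Cp + L₂) * Cp) * ((β + H * (L₁ * Cp + L₂)) / (c₀ ^ 2 * α))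

/-- `C̃₂ = C̃₁ + C̃₁ C_p (L₁C_p + L₂) / c₀`. -/
def const₂ (α β L₁ L₂ c₀ Cp H : ℝ) : ℝ :=
  const₁ α β L₁ L₂ c₀ Cp H + const₁ α β L₁ L₂ c₀ Cp H * (Cp * ((L₁ * Cp + L₂) / c₀))

/-- `C̃₃ = (β^{1/2} + α^{-1/2}(L₁C_p + L₂)C_p) / c₀`. -/
def const₃ (α β L₁ L₂ c₀ Cp : ℝ) : ℝ :=
  (Real.sqrt β + (Real.sqrt α)⁻¹ * ((L₁ * Cp + L₂) * Cp)) / c₀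

end LOD

end

namespace LOD

variable {d : ℕ}

/-! ### Cells of a triangulation -/

/-! Write `L = L₁ * Cp + L₂` and let `|·|` be the `H¹` seminorm. Strong monotonicity and Galerkin
orthogonality give a Céa-type bound in every subspace `S` of `V_h` (`norm_galerkin_error_le`): for
all `w ∈ S`, `c₀ |u_h - u_S|` is at most `√β` times the energy norm of `u_h - w` plus `L` times its
`L²` norm. The `L²` norm is kept separate on purpose, because it is of higher order for fine
functions.

For the ideal space, `V_h` is the energy-orthogonal sum of `V^ms` and the fine space. Taking for `w`
the multiscale part of `u_h` leaves the fine part `f` as the error. Functions in the kernel of the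
quasi-interpolation satisfy `‖f‖ ≤ K₀ ‖H‖ |f|` (`norm_fst_le_of_mem_fineSpace`): (A6) is summed over
the cells, and shape regularity bounds the overlap of the patches. Testing the equation with `f`
removes the multiscale part from the energy form, so that `α |f|² ≤ ⟨g - F(u_h), f⟩`, and therefore
`|f|` is of order `‖H‖ ‖g‖` (`norm_fine_part_le`).

For the localized space, `w` is the best energy approximation `v` of the ideal solution, and `u_h -
v` splits into the ideal error and `u_h^ms - v`, whose energy norm is the minimum. No decay estimate
for the correctors enters, since the localization error stays inside the minimum.

The rest is functional-analytic support: the finite element spaces are finite dimensional and the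
energy form is definite on them, so that all projections exist and the minimum is attained. -/

theorem isCompact_hull (s : Finset (E d)) : IsCompact (hull s) :=
  s.finite_toSet.isCompact_convexHull (𝕜 := ℝ)

theorem measurableSet_hull (s : Finset (E d)) : MeasurableSet (hull s) :=
  (isCompact_hull s).isClosed.measurableSet

theorem diam_hull_pos (hd : 1 ≤ d) {K : Geometry.SimplicialComplex ℝ (E d)} {s : Finset (E d)}
    (hs : s ∈ cells K) : 0 < Metric.diam (hull s) := by
  obtain ⟨x, hx, y, hy, hxy⟩ := Finset.one_lt_card.1 (by have := hs.2; omega : 1 < s.card)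
  refine (dist_pos.2 hxy).trans_le (Metric.dist_le_diam_of_mem (isCompact_hull s).isBounded ?_ ?_)
  · exact subset_convexHull ℝ _ hx
  · exact subset_convexHull ℝ _ hy

/-- At most `d` points span a proper affine subspace, which is a null set. -/
theorem volume_convexHull_eq_zero {s : Finset (E d)} (hs : s.card ≤ d) :
    volume (hull s) = 0 := by
  rcases s.eq_empty_or_nonempty with rfl | hne
  · simp [hull]
  refine measure_mono_null (convexHull_subset_affineSpan _) (Measure.addHaar_affineSubspace _ _ ?_)
  intro htop
  have h1 := finrank_vectorSpan_image_finset_le ℝ (id : E d → E d) s (n := s.card - 1)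
    (by have := hne.card_pos; omega)
  have h2 : vectorSpan ℝ (s : Set (E d)) = ⊤ := by
    rw [← direction_affineSpan, htop, AffineSubspace.direction_top]
  rw [Finset.image_id, h2, finrank_top, finrank_euclideanSpace_fin] at h1
  have := hne.card_pos
  omega

/-- By conformity the intersection is the hull of the common vertices, and two different cells share
at most `d` of them. -/
theorem volume_hull_inter_hull {K : Geometry.SimplicialComplex ℝ (E d)} {s t : Finset (E d)}
    (hs : s ∈ cells K) (ht : t ∈ cells K) (hst : s ≠ t) : volume (hull s ∩ hull t) = 0 := by
  classical
  rw [K.convexHull_inter_convexHull hs.1 ht.1, ← Finset.coe_inter]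
  apply volume_convexHull_eq_zero
  have h1 : (s ∩ t).card < s.card := by
    refine Finset.card_lt_card ⟨Finset.inter_subset_left, fun h => hst ?_⟩
    exact Finset.eq_of_subset_of_card_le (fun x hx => (Finset.mem_inter.1 (h hx)).2)
      (by rw [hs.2, ht.2])
  have := hs.2
  omega

/-- A volume count after rescaling. Each cell is shrunk towards its vertex `z` until its diameter is
that of the smallest cell, `ε`. By convexity the shrunken cell stays inside the original one, and it
still contains a ball of radius `γ * ε`. These balls are disjoint up to null sets and lie in the
ball of radius `ε` around `z`. -/
theorem card_cells_of_mem_le (hd : 1 ≤ d) {γ : ℝ} (hγ : 0 < γ)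
    {K : Geometry.SimplicialComplex ℝ (E d)} (hK : ShapeRegular K γ) (z : E d)
    (S : Finset (Finset (E d))) (hS : ∀ s ∈ S, s ∈ cells K ∧ z ∈ s) :
    (S.card : ℝ) ≤ (γ ^ d)⁻¹ := by
  rcases S.eq_empty_or_nonempty with rfl | hne
  · simp only [Finset.card_empty, Nat.cast_zero]; positivity
  obtain ⟨s₀, hs₀, hmin⟩ := S.exists_min_image (fun s => Metric.diam (hull s)) hne
  set ε := Metric.diam (hull s₀) with hε
  have hε0 : 0 < ε := diam_hull_pos hd (hS _ hs₀).1
  have hball : ∀ s ∈ S, ∃ c, Metric.closedBall c (γ * ε) ⊆ hull s ∩ Metric.closedBall z ε := by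
    intro s hs
    obtain ⟨c, hc⟩ := hK s (hS s hs).1
    set D := Metric.diam (hull s)
    have hD : 0 < D := diam_hull_pos hd (hS s hs).1
    have hz : z ∈ hull s := subset_convexHull ℝ _ (hS s hs).2
    -- The new centre is the image of `c` under the homothety with centre `z` and ratio `ε / D ≤ 1`;
    -- `x` below is the preimage of `y`.
    refine ⟨z + (ε / D) • (c - z), fun y hy => ?_⟩
    set x := z + (D / ε) • (y - z) with hxdef
    have hyx : y = z + (ε / D) • (x - z) := by
      have : ε / D * (D / ε) = 1 := by field_simp
      rw [hxdef, add_sub_cancel_left, smul_smul, this, one_smul, add_sub_cancel]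
    have hx : x ∈ hull s := by
      apply hc
      rw [Metric.mem_closedBall, dist_eq_norm] at hy ⊢
      have e : x - c = (D / ε) • (y - (z + (ε / D) • (c - z))) := by
        have : D / ε * (ε / D) = 1 := by field_simp
        rw [← sub_sub, smul_sub, smul_smul, this, one_smul, hxdef]
        abel
      rw [e, norm_smul, Real.norm_of_nonneg (by positivity)]
      calc D / ε * ‖y - (z + (ε / D) • (c - z))‖ ≤ D / ε * (γ * ε) := by gcongr
        _ = γ * D := by field_simp
    have hle : ε / D ≤ 1 := (div_le_one hD).2 (hmin s hs)
    constructor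
    · rw [hyx]
      exact (convex_convexHull ℝ _).add_smul_sub_mem hz hx ⟨by positivity, hle⟩
    · rw [Metric.mem_closedBall, hyx, dist_eq_norm, add_sub_cancel_left, norm_smul,
        Real.norm_of_nonneg (by positivity), ← dist_eq_norm]
      calc ε / D * dist x z ≤ ε / D * D := by
            gcongr
            exact Metric.dist_le_diam_of_mem (isCompact_hull s).isBounded hx hz
        _ = ε := by field_simp
  choose! c hc using hball
  have hvol := measure_biUnion_finset₀ (μ := (volume : Measure (E d))) (s := S)
    (f := fun s => Metric.closedBall (c s) (γ * ε))
    (fun s hs t ht hst => measure_mono_null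
      (inter_subset_inter ((hc s hs).trans inter_subset_left) ((hc t ht).trans inter_subset_left))
      (volume_hull_inter_hull (hS s hs).1 (hS t ht).1 hst))
    (fun s _ => Metric.isClosed_closedBall.measurableSet.nullMeasurableSet)
  have hle : volume (⋃ s ∈ S, Metric.closedBall (c s) (γ * ε)) ≤
      volume (Metric.closedBall z ε) :=
    measure_mono (iUnion₂_subset fun s hs => (hc s hs).trans inter_subset_right)
  rw [hvol, Finset.sum_congr rfl (fun s _ => Measure.addHaar_closedBall' volume (c s)
    (by positivity : 0 ≤ γ * ε)), Measure.addHaar_closedBall' volume z hε0.le,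
    Finset.sum_const, nsmul_eq_mul, ← mul_assoc, finrank_euclideanSpace_fin] at hle
  have h1 : volume (Metric.closedBall (0 : E d) 1) ≠ 0 :=
    (Metric.measure_closedBall_pos _ _ one_pos).ne'
  have h2 : volume (Metric.closedBall (0 : E d) 1) ≠ ⊤ := measure_closedBall_lt_top.ne
  -- Cancelling the volume of the unit ball leaves `S.card * (γ * ε) ^ d ≤ ε ^ d`.
  rw [ENNReal.mul_le_mul_iff_left h1 h2, ← ENNReal.ofReal_natCast,
    ← ENNReal.ofReal_mul (by positivity), ENNReal.ofReal_le_ofReal_iff (by positivity),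
    mul_pow, ← mul_assoc] at hle
  rw [← one_div, le_div_iff₀ (by positivity)]
  have : 0 < ε ^ d := by positivity
  nlinarith

theorem IsTriangulation.finite_cells {K : Geometry.SimplicialComplex ℝ (E d)} {Ω : Set (E d)}
    (hK : IsTriangulation K Ω) : (cells K).Finite :=
  hK.finite.subset fun _ hs => hs.1

theorem IsTriangulation.subset_iUnion_hull {K : Geometry.SimplicialComplex ℝ (E d)} {Ω : Set (E d)}
    (hK : IsTriangulation K Ω) : Ω ⊆ ⋃ s ∈ cells K, hull s := by
  intro x hx
  obtain ⟨s, hs, hxs⟩ := K.mem_space_iff.1 (hK.space_eq ▸ subset_closure hx)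
  obtain ⟨t, ht, hst⟩ := hK.pure s hs
  exact mem_iUnion₂.2 ⟨t, ht, convexHull_mono (Finset.coe_subset.2 hst) hxs⟩

theorem diam_hull_le_maxMeshSize {K : Geometry.SimplicialComplex ℝ (E d)} {Ω : Set (E d)}
    (hK : IsTriangulation K Ω) {s : Finset (E d)} (hs : s ∈ cells K) :
    Metric.diam (hull s) ≤ maxMeshSize K := by
  have := hK.finite_cells.to_subtype
  exact le_ciSup (f := fun s : cells K => Metric.diam (hull s.1)) (Set.finite_range _).bddAbove
    ⟨s, hs⟩

theorem maxMeshSize_nonneg (K : Geometry.SimplicialComplex ℝ (E d)) : 0 ≤ maxMeshSize K :=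
  Real.iSup_nonneg fun _ => Metric.diam_nonneg

open Classical in
/-- In a shape regular triangulation, the number of cells that meet a given cell is bounded. -/
theorem card_cells_meeting_le (hd : 1 ≤ d) {γ : ℝ} (hγ : 0 < γ)
    {K : Geometry.SimplicialComplex ℝ (E d)} (hreg : ShapeRegular K γ)
    (S : Finset (Finset (E d))) (hS : ∀ s ∈ S, s ∈ cells K) {t : Finset (E d)} (ht : t ∈ cells K) :
    ((S.filter fun s => (hull t ∩ hull s).Nonempty).card : ℝ) ≤ (d + 1) * (γ ^ d)⁻¹ := by
  -- Conformity again: a cell that meets `t` shares a vertex with it, so the cells around the `d +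
  -- 1` vertices of `t` cover all cases.
  have hsub : (S.filter fun s => (hull t ∩ hull s).Nonempty) ⊆
      t.biUnion fun z => S.filter fun s => z ∈ s := by
    intro s hs
    obtain ⟨hsS, hne⟩ := Finset.mem_filter.1 hs
    rw [K.convexHull_inter_convexHull ht.1 (hS s hsS).1, convexHull_nonempty_iff] at hne
    obtain ⟨z, hzt, hzs⟩ := hne
    exact Finset.mem_biUnion.2 ⟨z, hzt, Finset.mem_filter.2 ⟨hsS, hzs⟩⟩
  calc ((S.filter fun s => (hull t ∩ hull s).Nonempty).card : ℝ)
      ≤ ((t.biUnion fun z => S.filter fun s => z ∈ s).card : ℝ) := by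
        exact_mod_cast Finset.card_le_card hsub
    _ ≤ ∑ z ∈ t, ((S.filter fun s => z ∈ s).card : ℝ) := by
        exact_mod_cast Finset.card_biUnion_le
    _ ≤ ∑ _z ∈ t, (γ ^ d)⁻¹ := by
        refine Finset.sum_le_sum fun z _ => card_cells_of_mem_le hd hγ hreg z _ fun s hs => ?_
        exact ⟨hS s (Finset.mem_filter.1 hs).1, (Finset.mem_filter.1 hs).2⟩
    _ = (d + 1) * (γ ^ d)⁻¹ := by
        rw [Finset.sum_const, nsmul_eq_mul, ht.2]; push_cast; ring

theorem integral_biUnion_hull {K : Geometry.SimplicialComplex ℝ (E d)} {Ω : Set (E d)}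
    (S : Finset (Finset (E d))) (hS : ∀ s ∈ S, s ∈ cells K) {f : E d → ℝ}
    (hf : Integrable f (volume.restrict Ω)) :
    ∫ x in ⋃ s ∈ S, hull s, f x ∂(volume.restrict Ω) =
      ∑ s ∈ S, ∫ x in hull s, f x ∂(volume.restrict Ω) := by
  have h := integral_iUnion_ae (μ := volume.restrict Ω) (s := fun s : S => hull s.1) (f := f)
    (fun s => (measurableSet_hull s.1).nullMeasurableSet)
    (fun s t hst => Measure.absolutelyContinuous_of_le Measure.restrict_le_self
      (volume_hull_inter_hull (hS _ s.2) (hS _ t.2) fun h => hst (Subtype.ext h)))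
    hf.integrableOn
  rw [tsum_fintype, Finset.sum_coe_sort S fun s => ∫ x in hull s, f x ∂(volume.restrict Ω)] at h
  rw [← h]
  congr 2
  ext x
  simp

open Classical in
/-- The patches `ω_T` overlap finitely often. -/
theorem sum_integral_neighbourhood_le (hd : 1 ≤ d) {γ : ℝ} (hγ : 0 < γ)
    {K : Geometry.SimplicialComplex ℝ (E d)} {Ω : Set (E d)} (hK : IsTriangulation K Ω)
    (hreg : ShapeRegular K γ) {f : E d → ℝ} (hf : Integrable f (volume.restrict Ω))
    (hf0 : ∀ x, 0 ≤ f x) :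
    ∑ s ∈ hK.finite_cells.toFinset,
      ∫ x in neighbourhood K (hull s), f x ∂(volume.restrict Ω) ≤
      (d + 1) * (γ ^ d)⁻¹ * ∫ x, f x ∂(volume.restrict Ω) := by
  set S := hK.finite_cells.toFinset with hSdef
  have hS : ∀ s ∈ S, s ∈ cells K := fun s hs => hK.finite_cells.mem_toFinset.1 hs
  have hnb : ∀ s, ∫ x in neighbourhood K (hull s), f x ∂(volume.restrict Ω) =
      ∑ t ∈ S, if (hull t ∩ hull s).Nonempty then ∫ x in hull t, f x ∂(volume.restrict Ω)
        else 0 := by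
    intro s
    rw [← Finset.sum_filter, ← integral_biUnion_hull (K := K) _
      (fun t ht => hS t (Finset.mem_filter.1 ht).1) hf]
    congr 2
    simp [neighbourhood, hSdef]
  calc ∑ s ∈ S, ∫ x in neighbourhood K (hull s), f x ∂(volume.restrict Ω)
      -- After exchanging the sums, the integral over `t` appears once for every cell `s` that meets
      -- `t`.
      = ∑ t ∈ S, ((S.filter fun s => (hull t ∩ hull s).Nonempty).card : ℝ) *
          ∫ x in hull t, f x ∂(volume.restrict Ω) := by
        rw [Finset.sum_congr rfl fun s _ => hnb s, Finset.sum_comm]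
        refine Finset.sum_congr rfl fun t _ => ?_
        rw [← Finset.sum_filter, Finset.sum_const, nsmul_eq_mul]
    _ ≤ ∑ t ∈ S, (d + 1) * (γ ^ d)⁻¹ * ∫ x in hull t, f x ∂(volume.restrict Ω) := by
        refine Finset.sum_le_sum fun t ht => ?_
        exact mul_le_mul_of_nonneg_right (card_cells_meeting_le hd hγ hreg S hS (hS t ht))
          (integral_nonneg hf0)
    _ = (d + 1) * (γ ^ d)⁻¹ * ∫ x in ⋃ s ∈ S, hull s, f x ∂(volume.restrict Ω) := by
        rw [← Finset.mul_sum, integral_biUnion_hull S hS hf]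
    _ ≤ (d + 1) * (γ ^ d)⁻¹ * ∫ x, f x ∂(volume.restrict Ω) :=
        mul_le_mul_of_nonneg_left
          (setIntegral_le_integral hf (Eventually.of_forall hf0)) (by positivity)

theorem integral_eq_sum_integral_hull {K : Geometry.SimplicialComplex ℝ (E d)} {Ω : Set (E d)}
    (hΩ : MeasurableSet Ω) (hK : IsTriangulation K Ω) {f : E d → ℝ}
    (hf : Integrable f (volume.restrict Ω)) :
    ∫ x, f x ∂(volume.restrict Ω) =
      ∑ s ∈ hK.finite_cells.toFinset, ∫ x in hull s, f x ∂(volume.restrict Ω) := by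
  rw [← integral_biUnion_hull (K := K) _ (fun s hs => hK.finite_cells.mem_toFinset.1 hs) hf,
    Measure.restrict_eq_self_of_ae_mem (μ := volume.restrict Ω)]
  filter_upwards [ae_restrict_mem hΩ] with x hx
  simpa using hK.subset_iUnion_hull hx

/-! ### The `L²` norm of functions in the kernel of the quasi-interpolation -/

theorem integrable_norm_sq {Ω : Set (E d)} {W : Type*} [NormedAddCommGroup W]
    (f : Lp W 2 (volume.restrict Ω)) : Integrable (fun x => ‖f x‖ ^ 2) (volume.restrict Ω) :=
  (Lp.memLp f).integrable_norm_pow (by norm_num)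

theorem norm_sq_eq_integral {Ω : Set (E d)} {W : Type*} [NormedAddCommGroup W]
    [InnerProductSpace ℝ W] (f : Lp W 2 (volume.restrict Ω)) :
    ‖f‖ ^ 2 = ∫ x, ‖f x‖ ^ 2 ∂(volume.restrict Ω) := by
  rw [← real_inner_self_eq_norm_sq, L2.inner_def]
  simp only [real_inner_self_eq_norm_sq]

/-- The constant in the `L²` estimate of the functions in the kernel of the quasi-interpolation. -/
noncomputable def fineConst (d : ℕ) (γ CI : ℝ) : ℝ := |CI| * Real.sqrt ((d + 1) * (γ ^ d)⁻¹)

theorem fineConst_nonneg (d : ℕ) (γ CI : ℝ) : 0 ≤ fineConst d γ CI :=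
  mul_nonneg (abs_nonneg _) (Real.sqrt_nonneg _)

/-- With `I v = 0`, the first term of (A6) is a local bound of `v` itself by its gradient on `ω_T`.
It is squared, summed over the cells and combined with the finite overlap of the patches. -/
theorem norm_fst_le_of_mem_fineSpace (hd : 1 ≤ d) {γ CI CI' : ℝ} (hγ : 0 < γ)
    {Kh KH : Geometry.SimplicialComplex ℝ (E d)} {Ω : Set (E d)} (hΩ : MeasurableSet Ω)
    (hK : IsTriangulation KH Ω) (hreg : ShapeRegular KH γ) {href : Refines Kh KH}
    {I : femSpace Kh Ω →ₗ[ℝ] femSpace KH Ω} (hI : IsQuasiInterpolation href I CI CI')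
    {v : L2Pair Ω} (hv : v ∈ fineSpace I) :
    ‖v.1‖ ≤ fineConst d γ CI * maxMeshSize KH * ‖v.2‖ := by
  obtain ⟨w, hw, rfl⟩ := hv
  have hIw : I w = 0 := hw
  set v : L2Pair Ω := (femSpace Kh Ω).subtype w with hvdef
  have hH := maxMeshSize_nonneg KH
  have hcell : ∀ s ∈ cells KH, ∫ x in hull s, ‖v.1 x‖ ^ 2 ∂(volume.restrict Ω) ≤
      (CI * maxMeshSize KH) ^ 2 *
        ∫ x in neighbourhood KH (hull s), ‖v.2 x‖ ^ 2 ∂(volume.restrict Ω) := by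
    intro s hs
    have h := hI.approx w s hs
    have hD := diam_hull_pos hd hs
    have hDH := diam_hull_le_maxMeshSize hK hs
    rw [hIw, ZeroMemClass.coe_zero, sub_zero] at h
    change _ * l2On Ω (hull s) v.1 + l2On Ω (hull s) v.2 ≤
      CI * l2On Ω (neighbourhood KH (hull s)) v.2 at h
    have h0 : 0 ≤ l2On Ω (hull s) v.1 := Real.sqrt_nonneg _
    have h1 : 0 ≤ l2On Ω (hull s) v.2 := Real.sqrt_nonneg _
    have h2 : (Metric.diam (hull s))⁻¹ * l2On Ω (hull s) v.1 ≤
      CI * l2On Ω (neighbourhood KH (hull s)) v.2 := by linarith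
    rw [inv_mul_le_iff₀ hD] at h2
    -- No sign of `CI` is assumed; the estimate itself forces its right-hand side to be nonnegative.
    -- This is also why `fineConst` contains `|CI|`.
    have h3 : 0 ≤ CI * l2On Ω (neighbourhood KH (hull s)) v.2 :=
      nonneg_of_mul_nonneg_right (h0.trans h2) hD
    have h4 : l2On Ω (hull s) v.1 ≤
        maxMeshSize KH * (CI * l2On Ω (neighbourhood KH (hull s)) v.2) :=
      h2.trans (mul_le_mul_of_nonneg_right hDH h3)
    have h5 := pow_le_pow_left₀ h0 h4 2
    rw [← mul_assoc, mul_pow, l2On, l2On, Real.sq_sqrt (integral_nonneg fun _ => by positivity),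
      Real.sq_sqrt (integral_nonneg fun _ => by positivity), mul_comm (maxMeshSize KH)] at h5
    exact h5
  have hN : 0 ≤ ((d : ℝ) + 1) * (γ ^ d)⁻¹ := by positivity
  refine abs_le_of_sq_le_sq' ?_ (by have := fineConst_nonneg d γ CI; positivity) |>.2
  calc ‖v.1‖ ^ 2
      = ∑ s ∈ hK.finite_cells.toFinset, ∫ x in hull s, ‖v.1 x‖ ^ 2 ∂(volume.restrict Ω) := by
        rw [norm_sq_eq_integral, integral_eq_sum_integral_hull hΩ hK (integrable_norm_sq _)]
    _ ≤ ∑ s ∈ hK.finite_cells.toFinset, (CI * maxMeshSize KH) ^ 2 *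
        ∫ x in neighbourhood KH (hull s), ‖v.2 x‖ ^ 2 ∂(volume.restrict Ω) :=
        Finset.sum_le_sum fun s hs => hcell s (hK.finite_cells.mem_toFinset.1 hs)
    _ ≤ (CI * maxMeshSize KH) ^ 2 * ((d + 1) * (γ ^ d)⁻¹ * ‖v.2‖ ^ 2) := by
        rw [← Finset.mul_sum, norm_sq_eq_integral v.2]
        gcongr
        exact sum_integral_neighbourhood_le hd hγ hK hreg (integrable_norm_sq _)
          fun _ => by positivity
    _ = (fineConst d γ CI * maxMeshSize KH * ‖v.2‖) ^ 2 := by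
        rw [fineConst, mul_pow, mul_pow, mul_pow, mul_pow, Real.sq_sqrt hN, sq_abs]
        ring

end LOD

namespace LOD

variable {d : ℕ} {Ω : Set (E d)}

/-! ### The energy form -/

theorem mulE_mul (M N : Matrix (Fin d) (Fin d) ℝ) (ζ : E d) :
    mulE (M * N) ζ = mulE M (mulE N ζ) := by
  simp [mulE, map_mul]

/-- Links the norm `energyNorm`, defined through `CFC.sqrt`, to the form `aForm`. The root is
self-adjoint and squares to `M` because `M` is positive semidefinite. -/
theorem inner_mulE_sqrt {M : Matrix (Fin d) (Fin d) ℝ} (hM : M.IsSymm)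
    (hpos : ∀ ζ : E d, 0 ≤ inner ℝ (mulE M ζ) ζ) (ζ η : E d) :
    inner ℝ (mulE (CFC.sqrt M) ζ) (mulE (CFC.sqrt M) η) = inner ℝ (mulE M ζ) η := by
  have hherm : M.IsHermitian := by
    rw [Matrix.IsHermitian, Matrix.conjTranspose_eq_transpose_of_trivial]; exact hM
  have hpsd : M.PosSemidef := by
    refine Matrix.PosSemidef.of_dotProduct_mulVec_nonneg hherm fun x => ?_
    have := hpos (WithLp.toLp 2 x)
    simpa [mulE, EuclideanSpace.inner_eq_star_dotProduct, dotProduct_comm] using this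
  have h0 : 0 ≤ M := hpsd.nonneg
  have hsa : IsSelfAdjoint (Matrix.toEuclideanCLM (n := Fin d) (𝕜 := ℝ) (CFC.sqrt M)) := by
    have h1 : IsSelfAdjoint (CFC.sqrt M) := (CFC.sqrt_nonneg M).isSelfAdjoint
    exact h1.map (Matrix.toEuclideanCLM (n := Fin d) (𝕜 := ℝ))
  calc inner ℝ (mulE (CFC.sqrt M) ζ) (mulE (CFC.sqrt M) η)
      = inner ℝ (mulE (CFC.sqrt M) (mulE (CFC.sqrt M) ζ)) η := by
        have := hsa.isSymmetric (mulE (CFC.sqrt M) ζ) η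
        simpa using this.symm
    _ = inner ℝ (mulE M ζ) η := by rw [← mulE_mul, CFC.sqrt_mul_sqrt_self M h0]

namespace IsCoefficient

variable {A : E d → Matrix (Fin d) (Fin d) ℝ} {α β : ℝ}

theorem ae_inner_eq (hA : IsCoefficient Ω A α β) : ∀ᵐ x ∂(volume.restrict Ω), ∀ ζ η : E d,
    inner ℝ (mulE (A x) ζ) η =
      inner ℝ (mulE (CFC.sqrt (A x)) ζ) (mulE (CFC.sqrt (A x)) η) := by
  filter_upwards [hA.symm, hA.lower] with x h1 h2 ζ η
  refine (inner_mulE_sqrt h1 (fun ζ => le_trans ?_ (h2 ζ)) ζ η).symm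
  have := hA.pos
  positivity

theorem le_upper (hd : 1 ≤ d) (hΩ : IsOpen Ω) (hne : Ω.Nonempty) (hA : IsCoefficient Ω A α β) :
    α ≤ β := by
  have hvol : volume.restrict Ω ≠ 0 := by
    rw [Ne, Measure.restrict_eq_zero]
    exact (hΩ.measure_pos _ hne).ne'
  have : (ae (volume.restrict Ω)).NeBot := ae_neBot.2 hvol
  obtain ⟨x, h1, h2⟩ := (hA.lower.and hA.upper).exists
  have h := (h1 (EuclideanSpace.single ⟨0, hd⟩ 1)).trans (h2 _)
  simpa using h

/-- Cauchy-Schwarz after splitting `A` into two square roots gives the sharp factor `β`; it provides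
the integrable majorant for the energy form. -/
theorem ae_abs_inner_le (hA : IsCoefficient Ω A α β) : ∀ᵐ x ∂(volume.restrict Ω), ∀ ζ η : E d,
    |inner ℝ (mulE (A x) ζ) η| ≤ β * (‖ζ‖ * ‖η‖) := by
  filter_upwards [hA.ae_inner_eq, hA.upper, hA.lower] with x h1 h2 h3 ζ η
  have hβ : 0 ≤ β * ‖ζ‖ ^ 2 := by
    refine le_trans ?_ ((h3 ζ).trans (h2 ζ))
    have := hA.pos
    positivity
  have key : ∀ ζ : E d, ‖mulE (CFC.sqrt (A x)) ζ‖ ^ 2 ≤ β * ‖ζ‖ ^ 2 := fun ζ => by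
    rw [← real_inner_self_eq_norm_sq, ← h1]
    exact h2 ζ
  -- The sign of `β` can be read off from `hβ` only for a nonzero vector.
  by_cases hζ : ζ = 0
  · simp [hζ]
  have hβ0 : 0 ≤ β := nonneg_of_mul_nonneg_left hβ (by positivity)
  rw [h1]
  refine (abs_real_inner_le_norm _ _).trans
    (abs_le_of_sq_le_sq' ?_ (by positivity) |>.2)
  calc (‖mulE (CFC.sqrt (A x)) ζ‖ * ‖mulE (CFC.sqrt (A x)) η‖) ^ 2
      = ‖mulE (CFC.sqrt (A x)) ζ‖ ^ 2 * ‖mulE (CFC.sqrt (A x)) η‖ ^ 2 := by ring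
    _ ≤ (β * ‖ζ‖ ^ 2) * (β * ‖η‖ ^ 2) := by gcongr <;> exact key _
    _ = (β * (‖ζ‖ * ‖η‖)) ^ 2 := by ring

theorem aestronglyMeasurable (hA : IsCoefficient Ω A α β) (u w : L2Pair Ω) :
    AEStronglyMeasurable (fun x => inner ℝ (mulE (A x) (u.2 x)) (w.2 x)) (volume.restrict Ω) := by
  have h : (fun x => inner ℝ (mulE (A x) (u.2 x)) (w.2 x)) =
      fun x => ∑ i, w.2 x i * ∑ j, A x i j * u.2 x j := by
    funext x
    simp [mulE, EuclideanSpace.inner_eq_star_dotProduct, dotProduct, Matrix.mulVec]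
  rw [h]
  have hu : ∀ (u : L2Pair Ω) i, AEMeasurable (fun x => u.2 x i) (volume.restrict Ω) := fun u i =>
    (EuclideanSpace.proj (𝕜 := ℝ) i).measurable.comp_aemeasurable
      (Lp.aestronglyMeasurable u.2).aemeasurable
  exact (Finset.aemeasurable_fun_sum _ fun i _ => (hu w i).mul
    (Finset.aemeasurable_fun_sum _ fun j _ => (hA.measurable i j).mul (hu u j))).aestronglyMeasurable

theorem integrable (hA : IsCoefficient Ω A α β) (u w : L2Pair Ω) :
    Integrable (fun x => inner ℝ (mulE (A x) (u.2 x)) (w.2 x)) (volume.restrict Ω) := by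
  have h : Integrable (fun x => β * (‖u.2 x‖ * ‖w.2 x‖)) (volume.restrict Ω) :=
    ((Lp.memLp u.2).norm.integrable_mul (Lp.memLp w.2).norm).const_mul β
  refine h.mono' (hA.aestronglyMeasurable u w) ?_
  filter_upwards [hA.ae_abs_inner_le] with x hx
  exact hx _ _

theorem aForm_comm (hA : IsCoefficient Ω A α β) (u w : L2Pair Ω) :
    aForm A u w = aForm A w u := by
  refine integral_congr_ae ?_
  filter_upwards [hA.ae_inner_eq] with x hx
  simp only [hx]
  exact real_inner_comm _ _

theorem aForm_add_left (hA : IsCoefficient Ω A α β) (u v w : L2Pair Ω) :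
    aForm A (u + v) w = aForm A u w + aForm A v w := by
  rw [aForm, aForm, aForm, ← integral_add (hA.integrable u w) (hA.integrable v w)]
  refine integral_congr_ae ?_
  filter_upwards [Lp.coeFn_add u.2 v.2] with x hx
  simp only [Prod.snd_add, hx, Pi.add_apply, map_add, inner_add_left]

theorem aForm_smul_left (c : ℝ) (u w : L2Pair Ω) :
    aForm A (c • u) w = c * aForm A u w := by
  rw [aForm, aForm, ← integral_const_mul]
  refine integral_congr_ae ?_
  filter_upwards [Lp.coeFn_smul c u.2] with x hx
  simp only [Prod.smul_snd, hx, Pi.smul_apply, map_smul, real_inner_smul_left]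

/-- The energy form `⟨A∇·, ∇·⟩` as a bilinear form. -/
noncomputable def bilin (hA : IsCoefficient Ω A α β) : LinearMap.BilinForm ℝ (L2Pair Ω) :=
  LinearMap.mk₂ ℝ (aForm A) hA.aForm_add_left aForm_smul_left
    (fun u v w => by
      rw [hA.aForm_comm, hA.aForm_add_left, hA.aForm_comm v, hA.aForm_comm w])
    (fun c u v => by
      rw [hA.aForm_comm, aForm_smul_left, hA.aForm_comm v, smul_eq_mul])

@[simp]
theorem bilin_apply (hA : IsCoefficient Ω A α β) (u w : L2Pair Ω) :
    hA.bilin u w = aForm A u w := rfl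

theorem lower_aForm (hA : IsCoefficient Ω A α β) (u : L2Pair Ω) :
    α * ‖u.2‖ ^ 2 ≤ aForm A u u := by
  rw [norm_sq_eq_integral, ← integral_const_mul]
  refine integral_mono_ae ((integrable_norm_sq u.2).const_mul α) (hA.integrable u u) ?_
  filter_upwards [hA.lower] with x hx
  exact hx _

theorem aForm_upper (hA : IsCoefficient Ω A α β) (u : L2Pair Ω) :
    aForm A u u ≤ β * ‖u.2‖ ^ 2 := by
  rw [norm_sq_eq_integral, ← integral_const_mul]
  refine integral_mono_ae (hA.integrable u u) ((integrable_norm_sq u.2).const_mul β) ?_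
  filter_upwards [hA.upper] with x hx
  exact hx _

theorem aForm_self_nonneg (hA : IsCoefficient Ω A α β) (u : L2Pair Ω) : 0 ≤ aForm A u u :=
  le_trans (mul_nonneg hA.pos.le (sq_nonneg _)) (hA.lower_aForm u)

theorem energyNorm_eq (hA : IsCoefficient Ω A α β) (u : L2Pair Ω) :
    energyNorm A u = Real.sqrt (aForm A u u) := by
  rw [energyNorm, aForm]
  congr 1
  refine integral_congr_ae ?_
  filter_upwards [hA.ae_inner_eq] with x hx
  simp only [hx, real_inner_self_eq_norm_sq]

theorem energyNorm_sq (hA : IsCoefficient Ω A α β) (u : L2Pair Ω) :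
    energyNorm A u ^ 2 = aForm A u u := by
  rw [hA.energyNorm_eq, Real.sq_sqrt (hA.aForm_self_nonneg u)]

theorem abs_aForm_le (hA : IsCoefficient Ω A α β) (u w : L2Pair Ω) :
    |aForm A u w| ≤ energyNorm A u * energyNorm A w := by
  refine abs_le_of_sq_le_sq ?_ (mul_nonneg (Real.sqrt_nonneg _) (Real.sqrt_nonneg _))
  rw [mul_pow, hA.energyNorm_sq, hA.energyNorm_sq]
  exact hA.bilin.apply_sq_le_of_symm hA.aForm_self_nonneg ⟨hA.aForm_comm⟩ u w

theorem energyNorm_le (hA : IsCoefficient Ω A α β) (u : L2Pair Ω) :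
    energyNorm A u ≤ Real.sqrt β * ‖u.2‖ := by
  rw [hA.energyNorm_eq, ← Real.sqrt_sq (norm_nonneg u.2), ← Real.sqrt_mul' _ (sq_nonneg _)]
  exact Real.sqrt_le_sqrt (hA.aForm_upper u)

theorem norm_snd_le (hA : IsCoefficient Ω A α β) (u : L2Pair Ω) :
    ‖u.2‖ ≤ (Real.sqrt α)⁻¹ * energyNorm A u := by
  rw [inv_mul_eq_div, le_div_iff₀ (Real.sqrt_pos.2 hA.pos), mul_comm, hA.energyNorm_eq,
    ← Real.sqrt_sq (norm_nonneg u.2), ← Real.sqrt_mul hA.pos.le]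
  exact Real.sqrt_le_sqrt (hA.lower_aForm u)

end IsCoefficient

/-! ### The nonlinearity -/

namespace IsNonlinearity

variable {F : E d → ℝ → E d → ℝ} {L₁ L₂ : ℝ}

theorem ae_abs_sub_le (hF : IsNonlinearity Ω F L₁ L₂) (u v : L2Pair Ω) :
    ∀ᵐ x ∂(volume.restrict Ω), |F x (u.1 x) (u.2 x) - F x (v.1 x) (v.2 x)| ≤
      L₁ * ‖(u - v).1 x‖ + L₂ * ‖(u - v).2 x‖ := by
  filter_upwards [hF.lipschitz₁, hF.lipschitz₂, Lp.coeFn_sub u.1 v.1, Lp.coeFn_sub u.2 v.2]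
    with x h1 h2 h3 h4
  rw [Prod.fst_sub, Prod.snd_sub, h3, h4]
  exact (abs_sub_le _ (F x (v.1 x) (u.2 x)) _).trans (add_le_add (h1 _ _ _) (h2 _ _ _))

theorem memLp (hF : IsNonlinearity Ω F L₁ L₂) (u : L2Pair Ω) :
    MemLp (fun x => F x (u.1 x) (u.2 x)) 2 (volume.restrict Ω) := by
  have hm : AEStronglyMeasurable (fun x => F x (u.1 x) (u.2 x)) (volume.restrict Ω) := by
    have h1 := (Lp.aestronglyMeasurable u.1).aemeasurable
    have h2 := (Lp.aestronglyMeasurable u.2).aemeasurable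
    exact (hF.measurable.comp_aemeasurable
      (aemeasurable_id.prodMk (h1.prodMk h2))).aestronglyMeasurable
  refine MemLp.mono' (((Lp.memLp u.1).norm.const_mul L₁).add
    ((Lp.memLp u.2).norm.const_mul L₂)) hm ?_
  filter_upwards [hF.ae_abs_sub_le u 0, hF.zero, Lp.coeFn_zero ℝ 2 (volume.restrict Ω),
    Lp.coeFn_zero (E d) 2 (volume.restrict Ω)] with x h1 h2 h3 h4
  simp only [Prod.fst_zero, Prod.snd_zero, h3, h4, Pi.zero_apply, h2, sub_zero] at h1
  exact h1

/-- The superposition operator `u ↦ F(·, u, ∇u)`. -/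
noncomputable def superposition (hF : IsNonlinearity Ω F L₁ L₂) (u : L2Pair Ω) :
    Lp ℝ 2 (volume.restrict Ω) := (hF.memLp u).toLp

theorem superposition_zero (hF : IsNonlinearity Ω F L₁ L₂) : hF.superposition 0 = 0 := by
  refine Lp.ext ?_
  filter_upwards [(hF.memLp 0).coeFn_toLp, hF.zero, Lp.coeFn_zero ℝ 2 (volume.restrict Ω),
    Lp.coeFn_zero (E d) 2 (volume.restrict Ω)] with x h1 h2 h3 h4
  rw [superposition, h1, Prod.fst_zero, Prod.snd_zero, h3, h4]
  exact h2

theorem norm_superposition_sub_le (hF : IsNonlinearity Ω F L₁ L₂) (u v : L2Pair Ω) :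
    ‖hF.superposition u - hF.superposition v‖ ≤ L₁ * ‖(u - v).1‖ + L₂ * ‖(u - v).2‖ := by
  -- The pointwise norms are made elements of `L²`, so that the pointwise Lipschitz bound becomes a
  -- triangle inequality in `L²`.
  set p := (Lp.memLp (u - v).1).norm.toLp with hp
  set q := (Lp.memLp (u - v).2).norm.toLp with hq
  have hpn : ‖p‖ = ‖(u - v).1‖ := by
    rw [hp, Lp.norm_toLp, eLpNorm_norm, Lp.norm_def]
  have hqn : ‖q‖ = ‖(u - v).2‖ := by
    rw [hq, Lp.norm_toLp, eLpNorm_norm, Lp.norm_def]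
  calc ‖hF.superposition u - hF.superposition v‖ ≤ ‖L₁ • p + L₂ • q‖ := by
        refine Lp.norm_le_norm_of_ae_le ?_
        filter_upwards [hF.ae_abs_sub_le u v, Lp.coeFn_sub (hF.superposition u)
          (hF.superposition v), (hF.memLp u).coeFn_toLp, (hF.memLp v).coeFn_toLp,
          (Lp.memLp (u - v).1).norm.coeFn_toLp, (Lp.memLp (u - v).2).norm.coeFn_toLp,
          Lp.coeFn_add (L₁ • p) (L₂ • q), Lp.coeFn_smul L₁ p, Lp.coeFn_smul L₂ q]
          with x h1 h2 h3 h4 h5 h6 h7 h8 h9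
        rw [h2, h7, Pi.sub_apply, Pi.add_apply, h8, h9, Pi.smul_apply, Pi.smul_apply,
          superposition, superposition, h3, h4, hp, hq, h5, h6]
        exact h1.trans (le_abs_self _)
    _ ≤ L₁ * ‖(u - v).1‖ + L₂ * ‖(u - v).2‖ := by
        refine (norm_add_le _ _).trans ?_
        rw [norm_smul, norm_smul, hpn, hqn, Real.norm_of_nonneg hF.pos₁.le,
          Real.norm_of_nonneg hF.pos₂.le]

end IsNonlinearity

theorem integral_mul_eq_inner (f g : Lp ℝ 2 (volume.restrict Ω)) :
    ∫ x, f x * g x ∂(volume.restrict Ω) = inner ℝ f g := by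
  rw [L2.inner_def]
  exact integral_congr_ae (Eventually.of_forall fun x => by simp [mul_comm])

theorem bForm_eq {A : E d → Matrix (Fin d) (Fin d) ℝ} {F : E d → ℝ → E d → ℝ} {L₁ L₂ : ℝ}
    (hF : IsNonlinearity Ω F L₁ L₂) (u w : L2Pair Ω) :
    bForm A F u w = aForm A u w + inner ℝ (hF.superposition u) w.1 := by
  rw [bForm, ← integral_mul_eq_inner]
  congr 1
  refine integral_congr_ae ?_
  filter_upwards [(hF.memLp u).coeFn_toLp] with x hx
  rw [IsNonlinearity.superposition, hx]

end LOD

namespace LOD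

variable {d : ℕ} {Ω : Set (E d)}

/-! ### Uniqueness of the weak gradient -/

/-- Integration by parts against a test function, for elements of `H¹₀(Ω)`. -/
theorem integral_gradient_mul_of_mem_H10 {u : L2Pair Ω} (hu : u ∈ H10 Ω) {ψ : E d → ℝ}
    (hψ : IsTestFunction Ω ψ) (e : E d) :
    ∫ x, inner ℝ (ψ x • e) (u.2 x) ∂(volume.restrict Ω) +
      ∫ x, fderiv ℝ ψ x e * u.1 x ∂(volume.restrict Ω) = 0 := by
  obtain ⟨hψs, hψc, hψt⟩ := hψ
  have hdψ : Continuous fun x => fderiv ℝ ψ x e :=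
    (hψs.continuous_fderiv (by simp)).clm_apply continuous_const
  have hdψc : HasCompactSupport fun x => fderiv ℝ ψ x e := hψc.fderiv_apply (𝕜 := ℝ) e
  have hP : MemLp (fun x => ψ x • e) 2 (volume.restrict Ω) :=
    ((hψs.continuous.smul continuous_const).memLp_of_hasCompactSupport hψc.smul_right).restrict Ω
  have hQ : MemLp (fun x => fderiv ℝ ψ x e) 2 (volume.restrict Ω) :=
    (hdψ.memLp_of_hasCompactSupport hdψc).restrict Ω
  have key : ∀ u : L2Pair Ω, ∫ x, inner ℝ (ψ x • e) (u.2 x) ∂(volume.restrict Ω) +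
      ∫ x, fderiv ℝ ψ x e * u.1 x ∂(volume.restrict Ω) =
      inner ℝ hP.toLp u.2 + inner ℝ hQ.toLp u.1 := by
    intro u
    rw [← integral_mul_eq_inner, L2.inner_def]
    congr 1
    · refine integral_congr_ae ?_
      filter_upwards [hP.coeFn_toLp] with x hx
      rw [hx]
    · refine integral_congr_ae ?_
      filter_upwards [hQ.coeFn_toLp] with x hx
      rw [hx]
  -- The identity is a continuous linear condition on `u`, so it passes from the pairs `(φ, ∇φ)` to
  -- their closure.
  have hcl : IsClosed {u : L2Pair Ω | inner ℝ hP.toLp u.2 + inner ℝ hQ.toLp u.1 = 0} :=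
    isClosed_eq (by fun_prop) continuous_const
  have hsub : (testPairs Ω : Set (L2Pair Ω)) ⊆
      {u : L2Pair Ω | inner ℝ hP.toLp u.2 + inner ℝ hQ.toLp u.1 = 0} := by
    rintro u ⟨φ, ⟨hφs, hφc, hφt⟩, h1, h2⟩
    change _ = _
    rw [← key]
    have hdφ : Continuous fun x => fderiv ℝ φ x e :=
      (hφs.continuous_fderiv (by simp)).clm_apply continuous_const
    have hibp := integral_mul_fderiv_eq_neg_fderiv_mul_of_integrable
      (μ := (volume : Measure (E d))) (f := ψ) (g := φ) (v := e)
      ((hdψ.mul hφs.continuous).integrable_of_hasCompactSupport hdψc.mul_right)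
      ((hψs.continuous.mul hdφ).integrable_of_hasCompactSupport hψc.mul_right)
      ((hψs.continuous.mul hφs.continuous).integrable_of_hasCompactSupport hψc.mul_right)
      (fun x _ => hψs.differentiable (by simp) x) (fun x _ => hφs.differentiable (by simp) x)
    have e1 : ∫ x, inner ℝ (ψ x • e) (u.2 x) ∂(volume.restrict Ω) =
        ∫ x, ψ x * fderiv ℝ φ x e := by
      rw [← setIntegral_eq_integral_of_forall_compl_eq_zero (s := Ω) (f := fun x =>
        ψ x * fderiv ℝ φ x e) fun x hx => by
          rw [image_eq_zero_of_notMem_tsupport fun h => hx (hψt h), zero_mul]]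
      refine integral_congr_ae ?_
      filter_upwards [h2] with x hx
      rw [hx, real_inner_smul_left, real_inner_comm, gradient, InnerProductSpace.toDual_symm_apply]
    have e2 : ∫ x, fderiv ℝ ψ x e * u.1 x ∂(volume.restrict Ω) =
        ∫ x, fderiv ℝ ψ x e * φ x := by
      rw [← setIntegral_eq_integral_of_forall_compl_eq_zero (s := Ω) (f := fun x =>
        fderiv ℝ ψ x e * φ x) fun x hx => by
          rw [image_eq_zero_of_notMem_tsupport fun h => hx (hφt h), mul_zero]]
      refine integral_congr_ae ?_
      filter_upwards [h1] with x hx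
      rw [hx]
    rw [e1, e2, hibp, neg_add_cancel]
  rw [key]
  exact closure_minimal hsub hcl hu

/-- Integration by parts shows that each component of the gradient is orthogonal to all test
functions. This is needed because a finite element function is described piecewise through its first
component only, whereas the ambient space consists of pairs. -/
theorem eq_zero_of_mem_H10_of_fst_eq_zero (hΩ : IsOpen Ω) (hb : Bornology.IsBounded Ω)
    {u : L2Pair Ω} (hu : u ∈ H10 Ω) (h : u.1 = 0) : u = 0 := by
  have : IsFiniteMeasure (volume.restrict Ω) := isFiniteMeasure_restrict.2 hb.measure_lt_top.ne
  have hint : Integrable u.2 (volume.restrict Ω) := (Lp.memLp u.2).integrable (by norm_num)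
  have hcoord : ∀ i, ∀ᵐ x ∂(volume : Measure (E d)), x ∈ Ω → u.2 x i = 0 := by
    intro i
    have hi : IntegrableOn (fun x => u.2 x i) Ω volume :=
      (EuclideanSpace.proj (𝕜 := ℝ) i).integrable_comp hint
    refine hΩ.ae_eq_zero_of_integral_contDiff_smul_eq_zero hi.locallyIntegrableOn ?_
    intro ψ hψ hψc hψt
    have h1 := integral_gradient_mul_of_mem_H10 hu ⟨hψ, hψc, hψt⟩ (EuclideanSpace.single i 1)
    have h2 : ∫ x, fderiv ℝ ψ x (EuclideanSpace.single i 1) * u.1 x ∂(volume.restrict Ω) = 0 := by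
      refine integral_eq_zero_of_ae ?_
      rw [h]
      filter_upwards [Lp.coeFn_zero ℝ 2 (volume.restrict Ω)] with x hx
      rw [hx, Pi.zero_apply, mul_zero]
    rw [h2, add_zero] at h1
    rw [← setIntegral_eq_integral_of_forall_compl_eq_zero (s := Ω) fun x hx => by
      rw [image_eq_zero_of_notMem_tsupport fun h => hx (hψt h), zero_smul], ← h1]
    refine integral_congr_ae (Eventually.of_forall fun x => ?_)
    simp [real_inner_smul_left, EuclideanSpace.inner_single_left]
  refine Prod.ext h (Lp.ext ?_)
  rw [← ae_all_iff] at hcoord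
  filter_upwards [(ae_restrict_iff' hΩ.measurableSet).2 (hcoord.mono fun x hx hxΩ i => hx i hxΩ),
    Lp.coeFn_zero (E d) 2 (volume.restrict Ω)] with x hx h0
  rw [Prod.snd_zero, h0]
  ext i
  exact hx i

/-! ### Finite dimensionality of the finite element spaces -/

theorem femSpace_le_H10 (K : Geometry.SimplicialComplex ℝ (E d)) : femSpace K Ω ≤ H10 Ω :=
  fun _ h => h.1

/-- The finite element functions together with their representations
`x ↦ (c s).1 + (c s).2 x` on the cells `s`. -/
noncomputable def piecewiseRep (K : Geometry.SimplicialComplex ℝ (E d)) (Ω : Set (E d)) :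
    Submodule ℝ (L2Pair Ω × (cells K → ℝ × Module.Dual ℝ (E d))) where
  carrier := {p | p.1 ∈ femSpace K Ω ∧ ∀ s : cells K, ∀ᵐ x ∂(volume.restrict Ω),
    x ∈ hull s.1 → p.1.1 x = (p.2 s).1 + (p.2 s).2 x}
  zero_mem' := by
    refine ⟨zero_mem _, fun s => ?_⟩
    filter_upwards [Lp.coeFn_zero ℝ 2 (volume.restrict Ω)] with x hx _
    simpa using hx
  add_mem' := by
    rintro p q ⟨hp, hp'⟩ ⟨hq, hq'⟩
    refine ⟨add_mem hp hq, fun s => ?_⟩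
    filter_upwards [hp' s, hq' s, Lp.coeFn_add p.1.1 q.1.1] with x h1 h2 h3 hx
    simp only [Prod.fst_add, Prod.snd_add, h3, Pi.add_apply, h1 hx, h2 hx, LinearMap.add_apply]
    ring
  smul_mem' := by
    rintro c p ⟨hp, hp'⟩
    refine ⟨Submodule.smul_mem _ c hp, fun s => ?_⟩
    filter_upwards [hp' s, Lp.coeFn_smul c p.1.1] with x h1 h3 hx
    simp only [Prod.smul_fst, Prod.smul_snd, h3, Pi.smul_apply, h1 hx, LinearMap.smul_apply,
      smul_eq_mul]
    ring

theorem map_fst_piecewiseRep (K : Geometry.SimplicialComplex ℝ (E d)) :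
    (piecewiseRep K Ω).map (LinearMap.fst ℝ _ _) = femSpace K Ω := by
  refine le_antisymm ?_ ?_
  · rintro _ ⟨p, hp, rfl⟩
    exact hp.1
  · intro u hu
    obtain ⟨v, ⟨-, hv⟩, huv⟩ := hu.2
    choose a ha using fun s : cells K => hv s.1 s.2
    refine ⟨(u, fun s => (a s 0, (a s).linear)), ⟨hu, fun s => ?_⟩, rfl⟩
    filter_upwards [huv] with x hx hxs
    rw [hx, ha s hxs]
    have := (a s).map_vadd 0 x
    simp only [vadd_eq_add, add_zero] at this
    rw [this, add_comm]

/-- The affine coefficients on the finitely many cells determine the function a.e. and hence its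
gradient. Thus `piecewiseRep` embeds into a finite-dimensional coefficient space, and the finite
element space is its image under the first projection. The detour through representations avoids
choosing coefficients linearly. -/
theorem finiteDimensional_femSpace (hΩ : IsOpen Ω) (hb : Bornology.IsBounded Ω)
    {K : Geometry.SimplicialComplex ℝ (E d)} (hK : IsTriangulation K Ω) :
    FiniteDimensional ℝ (femSpace K Ω) := by
  have := hK.finite_cells.to_subtype
  have hinj : Function.Injective
      ((LinearMap.snd ℝ (L2Pair Ω) (cells K → ℝ × Module.Dual ℝ (E d))).comp
        (piecewiseRep K Ω).subtype) := by
    refine (injective_iff_map_eq_zero _).2 ?_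
    rintro ⟨⟨u, c⟩, hu, huc⟩ hc
    obtain rfl : c = 0 := hc
    have h0 : u.1 = 0 := by
      refine Lp.ext ?_
      filter_upwards [ae_all_iff.2 huc, Lp.coeFn_zero ℝ 2 (volume.restrict Ω),
        ae_restrict_mem hΩ.measurableSet] with x hx h0 hxΩ
      obtain ⟨s, hs, hxs⟩ := mem_iUnion₂.1 (hK.subset_iUnion_hull hxΩ)
      rw [h0]
      simpa using hx ⟨s, hs⟩ hxs
    obtain rfl := eq_zero_of_mem_H10_of_fst_eq_zero hΩ hb (femSpace_le_H10 K hu) h0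
    rfl
  have : FiniteDimensional ℝ (piecewiseRep K Ω) := FiniteDimensional.of_injective _ hinj
  rw [← map_fst_piecewiseRep]
  infer_instance

/-! ### Projections in the energy form -/

theorem eq_zero_of_mem_H10_of_snd_eq_zero {Cp : ℝ} (hP : IsPoincareConstant Ω Cp) {u : L2Pair Ω}
    (hu : u ∈ H10 Ω) (h : u.2 = 0) : u = 0 := by
  refine Prod.ext ?_ h
  have := hP.2 u hu
  rw [h, norm_zero, mul_zero] at this
  exact norm_le_zero_iff.1 this

namespace IsCoefficient

variable {A : E d → Matrix (Fin d) (Fin d) ℝ} {α β : ℝ}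

/-- Ellipticity and the Poincaré inequality make the energy form definite on `S`. The induced map
from `S` to its dual is therefore injective, and surjective by equality of dimensions. -/
theorem exists_projection (hA : IsCoefficient Ω A α β) {Cp : ℝ} (hP : IsPoincareConstant Ω Cp)
    (S : Submodule ℝ (L2Pair Ω)) [FiniteDimensional ℝ S] (hS : S ≤ H10 Ω) (v : L2Pair Ω) :
    ∃ p, IsProjection A (S : Set (L2Pair Ω)) v p := by
  let T : S →ₗ[ℝ] Module.Dual ℝ S := hA.bilin.restrict S
  have hT : Function.Injective T := by
    rw [← LinearMap.ker_eq_bot, LinearMap.ker_eq_bot']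
    intro p hp
    have h1 : aForm A p.1 p.1 = 0 := LinearMap.congr_fun hp p
    have h2 := hA.lower_aForm p.1
    rw [h1] at h2
    have h3 : ‖p.1.2‖ ^ 2 ≤ 0 := nonpos_of_mul_nonpos_right h2 hA.pos
    have h4 : p.1.2 = 0 := by simpa using le_antisymm h3 (sq_nonneg _)
    exact Subtype.ext (eq_zero_of_mem_H10_of_snd_eq_zero hP (hS p.2) h4)
  have hsurj : Function.Surjective T :=
    (LinearMap.injective_iff_surjective_of_finrank_eq_finrank
      (Subspace.dual_finrank_eq (K := ℝ) (V := S)).symm).1 hT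
  obtain ⟨p, hp⟩ := hsurj ((hA.bilin v).comp S.subtype)
  exact ⟨p, p.2, fun w hw => LinearMap.congr_fun hp ⟨w, hw⟩⟩

/-- The orthogonal projection is the best approximation in the energy norm. -/
theorem isLeast_energyNorm (hA : IsCoefficient Ω A α β) {S : Submodule ℝ (L2Pair Ω)}
    {v p : L2Pair Ω} (hp : IsProjection A (S : Set (L2Pair Ω)) v p) :
    IsLeast {r : ℝ | ∃ w ∈ S, r = energyNorm A (v - w)} (energyNorm A (v - p)) := by
  refine ⟨⟨p, hp.1, rfl⟩, ?_⟩
  rintro _ ⟨w, hw, rfl⟩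
  rw [hA.energyNorm_eq, hA.energyNorm_eq]
  refine Real.sqrt_le_sqrt ?_
  have horth : hA.bilin (v - p) (p - w) = 0 := by
    rw [LinearMap.map_sub₂, sub_eq_zero]
    exact (hp.2 _ (sub_mem hp.1 hw)).symm
  have horth' : hA.bilin (p - w) (v - p) = 0 := (hA.aForm_comm _ _).trans horth
  have hdec : v - w = (v - p) + (p - w) := by abel
  have : hA.bilin (v - w) (v - w) = hA.bilin (v - p) (v - p) + hA.bilin (p - w) (p - w) := by
    rw [hdec, map_add, map_add, LinearMap.add_apply, LinearMap.add_apply, horth, horth']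
    ring
  have h0 := hA.aForm_self_nonneg (p - w)
  simp only [bilin_apply] at this
  linarith

theorem energyNorm_sub_le (hA : IsCoefficient Ω A α β) (u v w : L2Pair Ω) :
    energyNorm A (u - w) ≤ energyNorm A (u - v) + energyNorm A (v - w) := by
  have h0 : ∀ u : L2Pair Ω, 0 ≤ energyNorm A u := fun _ => Real.sqrt_nonneg _
  refine (abs_le_of_sq_le_sq' ?_ (add_nonneg (h0 _) (h0 _))).2
  have h1 : hA.bilin (u - w) (u - w) = hA.bilin (u - v) (u - v) + hA.bilin (u - v) (v - w) +
      (hA.bilin (v - w) (u - v) + hA.bilin (v - w) (v - w)) := by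
    rw [← sub_add_sub_cancel u v w, LinearMap.map_add₂, map_add, map_add]
  have h2 := (le_abs_self _).trans (hA.abs_aForm_le (u - v) (v - w))
  have h3 := hA.aForm_comm (v - w) (u - v)
  simp only [bilin_apply] at h1
  rw [hA.energyNorm_sq, add_sq, hA.energyNorm_sq, hA.energyNorm_sq]
  linarith

end IsCoefficient

end LOD

namespace LOD

variable {d : ℕ} {Ω : Set (E d)}

/-! ### The multiscale spaces -/

section Multiscale

variable {Kh KH : Geometry.SimplicialComplex ℝ (E d)} {href : Refines Kh KH}
  {I : femSpace Kh Ω →ₗ[ℝ] femSpace KH Ω} {A : E d → Matrix (Fin d) (Fin d) ℝ}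

theorem fineSpace_le_femSpace : fineSpace I ≤ femSpace Kh Ω := by
  rintro _ ⟨v, -, rfl⟩
  exact v.2

theorem msSpace_le_femSpace (href : Refines Kh KH) : msSpace A I ≤ femSpace Kh Ω := by
  refine Submodule.span_le.2 ?_
  rintro _ ⟨v, hv, p, hp, rfl⟩
  exact sub_mem (femSpace_mono href Ω hv) (fineSpace_le_femSpace hp.1)

theorem msSpaceLocal_le_femSpace (href : Refines Kh KH) (k : ℕ) :
    msSpaceLocal A I k ≤ femSpace Kh Ω := by
  refine Submodule.span_le.2 ?_
  rintro _ ⟨z, -, b, hb, p, hp, rfl⟩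
  exact sub_mem (femSpace_mono href Ω hb.1) (fineSpace_le_femSpace hp.1.1)

theorem aForm_eq_zero_of_mem_msSpace {α β : ℝ} (hA : IsCoefficient Ω A α β) {u w : L2Pair Ω}
    (hu : u ∈ msSpace A I) (hw : w ∈ fineSpace I) : aForm A u w = 0 := by
  suffices h : msSpace A I ≤ LinearMap.ker (hA.bilin.flip w) from h hu
  refine Submodule.span_le.2 ?_
  rintro _ ⟨v, -, p, hp, rfl⟩
  change hA.bilin (v - p) w = 0
  rw [LinearMap.map_sub₂, sub_eq_zero]
  exact (hp.2 w hw).symm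

/-- The decomposition `V_h = V^{ms} + V_h^f`. -/
theorem exists_sub_mem_msSpace {α β Cp CI CI' : ℝ} (hA : IsCoefficient Ω A α β)
    (hP : IsPoincareConstant Ω Cp) (hI : IsQuasiInterpolation href I CI CI')
    [FiniteDimensional ℝ (femSpace Kh Ω)] {u : L2Pair Ω} (hu : u ∈ femSpace Kh Ω) :
    ∃ f ∈ fineSpace I, u - f ∈ msSpace A I := by
  -- Choosing `v ∈ V_H` with `I v = I u` makes `u - v` fine. Since `v - p` is multiscale, the fine
  -- part of `u` is `u - v + p`.
  obtain ⟨v, hv⟩ := hI.bijective.2 (I ⟨u, hu⟩)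
  have : FiniteDimensional ℝ (fineSpace I) :=
    Submodule.finiteDimensional_of_le fineSpace_le_femSpace
  obtain ⟨p, hp⟩ := hA.exists_projection hP (fineSpace I)
    (fineSpace_le_femSpace.trans (femSpace_le_H10 Kh)) v.1
  have hfine : u - v.1 ∈ fineSpace I := by
    refine ⟨⟨u, hu⟩ - ⟨v.1, femSpace_mono href Ω v.2⟩, ?_, rfl⟩
    change I _ = 0
    rw [map_sub, sub_eq_zero]
    exact hv.symm
  refine ⟨u - v.1 + p, add_mem hfine hp.1, Submodule.subset_span ⟨v, v.2, p, hp, ?_⟩⟩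
  abel

end Multiscale

/-! ### Error estimates -/

section Estimates

variable {A : E d → Matrix (Fin d) (Fin d) ℝ} {F : E d → ℝ → E d → ℝ} {α β L₁ L₂ c₀ Cp : ℝ}

theorem IsNonlinearity.norm_superposition_sub_le_of_mem_H10 (hF : IsNonlinearity Ω F L₁ L₂)
    (hP : IsPoincareConstant Ω Cp) {u v : L2Pair Ω} (hu : u ∈ H10 Ω) (hv : v ∈ H10 Ω) :
    ‖hF.superposition u - hF.superposition v‖ ≤ (L₁ * Cp + L₂) * ‖(u - v).2‖ := by
  have h1 := hF.norm_superposition_sub_le u v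
  have h2 := mul_le_mul_of_nonneg_left (hP.2 _ (sub_mem hu hv)) hF.pos₁.le
  linarith

/-- The Poincaré inequality is applied to `u - v` but not to `w`: for a fine `w` the norm `‖w.1‖`
gains a factor of the mesh size. -/
theorem bForm_sub_le (hA : IsCoefficient Ω A α β) (hF : IsNonlinearity Ω F L₁ L₂)
    (hP : IsPoincareConstant Ω Cp) {u v : L2Pair Ω} (hu : u ∈ H10 Ω) (hv : v ∈ H10 Ω)
    (w : L2Pair Ω) :
    bForm A F u w - bForm A F v w ≤
      (Real.sqrt β * energyNorm A w + (L₁ * Cp + L₂) * ‖w.1‖) * ‖(u - v).2‖ := by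
  have h1 : aForm A u w - aForm A v w = aForm A (u - v) w :=
    (LinearMap.map_sub₂ hA.bilin u v w).symm
  have h2 : aForm A (u - v) w ≤ Real.sqrt β * ‖(u - v).2‖ * energyNorm A w :=
    (le_abs_self _).trans ((hA.abs_aForm_le _ _).trans
      (mul_le_mul_of_nonneg_right (hA.energyNorm_le _) (Real.sqrt_nonneg _)))
  have h3 : inner ℝ (hF.superposition u) w.1 - inner ℝ (hF.superposition v) w.1 ≤
      (L₁ * Cp + L₂) * ‖(u - v).2‖ * ‖w.1‖ := by
    rw [← inner_sub_left]
    exact (real_inner_le_norm _ _).trans (mul_le_mul_of_nonneg_right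
      (hF.norm_superposition_sub_le_of_mem_H10 hP hu hv) (norm_nonneg _))
  rw [bForm_eq hF, bForm_eq hF]
  linarith

/-- Quasi-optimality: if `u - v` is a Galerkin error with respect to a space that contains
`v - w`, then it is controlled by `u - w`. -/
theorem norm_galerkin_error_le (hA : IsCoefficient Ω A α β) (hF : IsNonlinearity Ω F L₁ L₂)
    (hB : StronglyMonotone Ω A F c₀) (hP : IsPoincareConstant Ω Cp)
    {g : Lp ℝ 2 (volume.restrict Ω)} {S T : Submodule ℝ (L2Pair Ω)} (hST : S ≤ T)
    (hT : T ≤ H10 Ω) {u v w : L2Pair Ω} (hu : IsGalerkinSolution A F g T u)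
    (hv : IsGalerkinSolution A F g S v) (hw : w ∈ S) :
    c₀ * ‖(u - v).2‖ ≤ Real.sqrt β * energyNorm A (u - w) + (L₁ * Cp + L₂) * ‖(u - w).1‖ := by
  have huH := hT hu.1
  have hvH := hT (hST hv.1)
  have hsub : ∀ x y z : L2Pair Ω, bForm A F x (y - z) = bForm A F x y - bForm A F x z := by
    intro x y z
    have h1 : aForm A x (y - z) = aForm A x y - aForm A x z := map_sub (hA.bilin x) y z
    rw [bForm_eq hF, bForm_eq hF, bForm_eq hF, h1, Prod.fst_sub, inner_sub_right]
    ring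
  have h1 := hB.2 u huH v hvH
  -- Galerkin orthogonality: `v - w` is an admissible test function in both spaces, so `u - v` may
  -- be replaced by `u - w` as test function.
  have h2 : bForm A F u (v - w) = bForm A F v (v - w) := by
    have hmem : v - w ∈ S := sub_mem hv.1 hw
    rw [hu.2 _ (hST hmem), hv.2 _ hmem]
  have h3 := bForm_sub_le hA hF hP huH hvH (u - w)
  have h4 : bForm A F u (u - v) - bForm A F v (u - v) =
      bForm A F u (u - w) - bForm A F v (u - w) := by
    have e : u - v = (u - w) - (v - w) := by abel
    rw [e, hsub u (u - w), hsub v (u - w), h2]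
    ring
  rw [h4] at h1
  have h5 := h1.trans h3
  rcases (norm_nonneg (u - v).2).eq_or_lt with h0 | h0
  · rw [← h0, mul_zero]
    have := hF.pos₁
    have := hF.pos₂
    have := hP.1
    have : 0 ≤ energyNorm A (u - w) := Real.sqrt_nonneg _
    positivity
  · rw [pow_two, ← mul_assoc] at h5
    exact le_of_mul_le_mul_right h5 h0

/-- Stability follows from monotonicity between `u` and `0`, because `B(0) = 0`. -/
theorem norm_galerkin_le (hF : IsNonlinearity Ω F L₁ L₂)
    (hB : StronglyMonotone Ω A F c₀) (hP : IsPoincareConstant Ω Cp)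
    {g : Lp ℝ 2 (volume.restrict Ω)} {T : Submodule ℝ (L2Pair Ω)} (hT : T ≤ H10 Ω)
    {u : L2Pair Ω} (hu : IsGalerkinSolution A F g T u) : c₀ * ‖u.2‖ ≤ Cp * ‖g‖ := by
  have h1 := hB.2 u (hT hu.1) 0 (zero_mem _)
  have ha : aForm A (0 : L2Pair Ω) u = 0 := by
    have := IsCoefficient.aForm_smul_left (A := A) 0 (0 : L2Pair Ω) u
    rwa [zero_smul, zero_mul] at this
  have h0 : bForm A F 0 u = 0 := by
    rw [bForm_eq hF, hF.superposition_zero, inner_zero_left, ha, add_zero]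
  rw [sub_zero, hu.2 u hu.1, h0, sub_zero, integral_mul_eq_inner] at h1
  have h2 : c₀ * ‖u.2‖ ^ 2 ≤ ‖g‖ * (Cp * ‖u.2‖) :=
    h1.trans ((real_inner_le_norm _ _).trans
      (mul_le_mul_of_nonneg_left (hP.2 u (hT hu.1)) (norm_nonneg _)))
  rcases (norm_nonneg u.2).eq_or_lt with h | h
  · rw [← h, mul_zero]
    have := hP.1
    positivity
  · refine le_of_mul_le_mul_right ?_ h
    linarith

/-- The fine part of the Galerkin solution is of the order of the mesh size. -/
theorem norm_fine_part_le (hA : IsCoefficient Ω A α β) (hF : IsNonlinearity Ω F L₁ L₂)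
    (hB : StronglyMonotone Ω A F c₀) (hP : IsPoincareConstant Ω Cp)
    {g : Lp ℝ 2 (volume.restrict Ω)} {T : Submodule ℝ (L2Pair Ω)} (hT : T ≤ H10 Ω)
    {u f : L2Pair Ω} (hu : IsGalerkinSolution A F g T u) (hf : f ∈ T)
    (horth : aForm A (u - f) f = 0) {κ : ℝ} (hκ : 0 ≤ κ) (hfκ : ‖f.1‖ ≤ κ * ‖f.2‖) :
    α * ‖f.2‖ ≤ κ * ((1 + Cp * ((L₁ * Cp + L₂) / c₀)) * ‖g‖) := by
  -- Testing with `f`, where orthogonality turns `aForm A u f` into `aForm A f f`.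
  have h1 : aForm A f f = inner ℝ (g - hF.superposition u) f.1 := by
    have e : aForm A (u - f) f = aForm A u f - aForm A f f :=
      LinearMap.map_sub₂ hA.bilin u f f
    have h := hu.2 f hf
    rw [bForm_eq hF, integral_mul_eq_inner] at h
    rw [inner_sub_left]
    linarith
  have hc := hB.1
  have hL : 0 ≤ L₁ * Cp + L₂ := by
    have := hF.pos₁; have := hF.pos₂; have := hP.1; positivity
  have hFu : ‖hF.superposition u‖ ≤ (L₁ * Cp + L₂) * ‖u.2‖ := by
    simpa [hF.superposition_zero] using
      hF.norm_superposition_sub_le_of_mem_H10 hP (hT hu.1) (zero_mem _)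
  have hun : ‖u.2‖ ≤ Cp * ‖g‖ / c₀ := by
    rw [le_div_iff₀ hc, mul_comm]
    exact norm_galerkin_le hF hB hP hT hu
  have hg : ‖g - hF.superposition u‖ ≤ (1 + Cp * ((L₁ * Cp + L₂) / c₀)) * ‖g‖ := by
    refine (norm_sub_le _ _).trans ?_
    have := mul_le_mul_of_nonneg_left hun hL
    calc ‖g‖ + ‖hF.superposition u‖ ≤ ‖g‖ + (L₁ * Cp + L₂) * (Cp * ‖g‖ / c₀) := by linarith
      _ = (1 + Cp * ((L₁ * Cp + L₂) / c₀)) * ‖g‖ := by ring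
  have h2 : α * ‖f.2‖ ^ 2 ≤ ((1 + Cp * ((L₁ * Cp + L₂) / c₀)) * ‖g‖) * (κ * ‖f.2‖) := by
    refine (hA.lower_aForm f).trans (h1.le.trans ((real_inner_le_norm _ _).trans ?_))
    gcongr
    exact (norm_nonneg _).trans hg
  rcases (norm_nonneg f.2).eq_or_lt with h | h
  · rw [← h, mul_zero]
    exact mul_nonneg hκ ((norm_nonneg _).trans hg)
  · refine le_of_mul_le_mul_right ?_ h
    linarith

end Estimates

end LOD

/-! ### The error estimate for the localized multiscale method. -/

theorem mainTheorem4 (d : ℕ) (hd : 1 ≤ d) (γ CI CI' : ℝ) (hγ : 0 < γ) :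
    ∃ C : ℝ, 0 < C ∧
      ∀ (Ω : Set (LOD.E d)), IsOpen Ω → Bornology.IsBounded Ω → Ω.Nonempty →
      ∀ (KH Kh : Geometry.SimplicialComplex ℝ (LOD.E d)),
        LOD.IsTriangulation KH Ω → LOD.IsTriangulation Kh Ω →
        LOD.ShapeRegular KH γ → LOD.ShapeRegular Kh γ →
      ∀ (href : LOD.Refines Kh KH)
        (I : LOD.femSpace Kh Ω →ₗ[ℝ] LOD.femSpace KH Ω),
        LOD.IsQuasiInterpolation href I CI CI' →
      ∀ (A : LOD.E d → Matrix (Fin d) (Fin d) ℝ) (F : LOD.E d → ℝ → LOD.E d → ℝ)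
        (α β L₁ L₂ c₀ Cp : ℝ),
        LOD.IsCoefficient Ω A α β → LOD.IsNonlinearity Ω F L₁ L₂ →
        LOD.StronglyMonotone Ω A F c₀ → LOD.IsPoincareConstant Ω Cp →
      ∀ (g : MeasureTheory.Lp ℝ 2 (MeasureTheory.volume.restrict Ω)) (k : ℕ), 1 ≤ k →
      ∀ (uh ums umsk : LOD.L2Pair Ω),
        LOD.IsGalerkinSolution A F g (LOD.femSpace Kh Ω) uh →
        LOD.IsGalerkinSolution A F g (LOD.msSpace A I) ums →
        LOD.IsGalerkinSolution A F g (LOD.msSpaceLocal A I k) umsk →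
      ∃ m : ℝ,
        IsLeast {r : ℝ | ∃ v ∈ LOD.msSpaceLocal A I k, r = LOD.energyNorm A (ums - v)} m ∧
        ‖(uh - umsk).2‖ ≤
          C * (LOD.const₂ α β L₁ L₂ c₀ Cp (LOD.maxMeshSize KH) * ‖g‖ * LOD.maxMeshSize KH
            + LOD.const₃ α β L₁ L₂ c₀ Cp * m) := by
  have hK0 := LOD.fineConst_nonneg d γ CI
  set K₀ := LOD.fineConst d γ CI
  -- One `K₀` comes from the bound of `|f|`, the factor `1 + K₀` from `β + K₀ * H * L ≤ (1 + K₀) *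
  -- (β + H * L)`, and the summand `1` serves the localization term.
  refine ⟨1 + K₀ * (1 + K₀), by positivity, ?_⟩
  intro Ω hΩ hb hne KH Kh hKH hKh hregH _ href I hI A F α β L₁ L₂ c₀ Cp hA hF hB hP g k _
    uh ums umsk huh hums humsk
  have hfd := LOD.finiteDimensional_femSpace hΩ hb hKh
  have hmsk := LOD.msSpaceLocal_le_femSpace (A := A) (I := I) href k
  have hms := LOD.msSpace_le_femSpace (A := A) (I := I) href
  have hH10 := LOD.femSpace_le_H10 (Ω := Ω) Kh
  have : FiniteDimensional ℝ (LOD.msSpaceLocal A I k) := Submodule.finiteDimensional_of_le hmsk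
  obtain ⟨v, hv⟩ := hA.exists_projection hP (LOD.msSpaceLocal A I k) (hmsk.trans hH10) ums
  refine ⟨_, hA.isLeast_energyNorm hv, ?_⟩
  obtain ⟨f, hf, huf⟩ := LOD.exists_sub_mem_msSpace hA hP hI huh.1
  set H := LOD.maxMeshSize KH
  have hH : 0 ≤ H := LOD.maxMeshSize_nonneg KH
  have hfκ : ‖f.1‖ ≤ K₀ * H * ‖f.2‖ :=
    LOD.norm_fst_le_of_mem_fineSpace hd hγ hΩ.measurableSet hKH hregH hI hf
  have hα := hA.pos
  have hβ : 0 ≤ β := hα.le.trans (hA.le_upper hd hΩ hne)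
  have hc := hB.1
  have hCp := hP.1
  have hL₁ := hF.pos₁
  have hL₂ := hF.pos₂
  have hfine := LOD.norm_fine_part_le hA hF hB hP hH10 huh (LOD.fineSpace_le_femSpace hf)
    (LOD.aForm_eq_zero_of_mem_msSpace hA huf hf) (by positivity) hfκ
  -- The competitor is the multiscale part `uh - f`, so the approximation error is exactly `f`.
  have herr₁ := LOD.norm_galerkin_error_le hA hF hB hP hms hH10 huh hums huf
  -- The competitor is the best approximation `v` of the ideal solution, not of `uh`, because this
  -- produces the minimum in the statement.
  have herr₂ := LOD.norm_galerkin_error_le hA hF hB hP hmsk hH10 huh humsk hv.1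
  rw [sub_sub_cancel] at herr₁
  set L := L₁ * Cp + L₂ with hLdef
  have hL : 0 ≤ L := by positivity
  set m := LOD.energyNorm A (ums - v)
  have hm0 : 0 ≤ m := Real.sqrt_nonneg _
  have hsβ := Real.mul_self_sqrt hβ
  -- the error of the ideal multiscale method
  have hδ : ‖(uh - ums).2‖ ≤ (β + K₀ * H * L) * ‖f.2‖ / c₀ := by
    rw [le_div_iff₀ hc, mul_comm]
    have h1 := mul_le_mul_of_nonneg_left (hA.energyNorm_le f) (Real.sqrt_nonneg β)
    have h2 := mul_le_mul_of_nonneg_left hfκ hL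
    rw [← mul_assoc, hsβ] at h1
    linarith
  have hfα : ‖f.2‖ ≤ K₀ * H * ((1 + Cp * (L / c₀)) * ‖g‖) / α := by
    rw [le_div_iff₀ hα, mul_comm]
    exact hfine
  -- the error of the localized method
  have htri : LOD.energyNorm A (uh - v) ≤ LOD.energyNorm A (uh - ums) + m :=
    hA.energyNorm_sub_le uh ums v
  have hmid : Real.sqrt β * LOD.energyNorm A (uh - v) + L * ‖(uh - v).1‖ ≤
      (β + L * Cp) * ‖(uh - ums).2‖ + (Real.sqrt β + (Real.sqrt α)⁻¹ * (L * Cp)) * m := by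
    have h1 := mul_le_mul_of_nonneg_left (hA.energyNorm_le (uh - ums)) (Real.sqrt_nonneg β)
    rw [← mul_assoc, hsβ] at h1
    have h2 := mul_le_mul_of_nonneg_left htri (Real.sqrt_nonneg β)
    have h3 : ‖(uh - v).1‖ ≤ Cp * ‖(uh - ums).2‖ + Cp * ((Real.sqrt α)⁻¹ * m) := by
      have e : (uh - v).1 = (uh - ums).1 + (ums - v).1 := by
        rw [← Prod.fst_add, sub_add_sub_cancel]
      rw [e]
      refine (norm_add_le _ _).trans (add_le_add
        (hP.2 _ (hH10 (sub_mem huh.1 (hms hums.1)))) ?_)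
      exact (hP.2 _ (hH10 (sub_mem (hms hums.1) (hmsk hv.1)))).trans
        (mul_le_mul_of_nonneg_left (hA.norm_snd_le _) hCp.le)
    have h4 := mul_le_mul_of_nonneg_left h3 hL
    linarith
  have hδ' : ‖(uh - ums).2‖ ≤ K₀ * (1 + K₀) *
      ((β + H * L) * (1 + Cp * (L / c₀)) / (c₀ * α)) * ‖g‖ * H := by
    refine hδ.trans ?_
    calc (β + K₀ * H * L) * ‖f.2‖ / c₀
        ≤ ((1 + K₀) * (β + H * L)) * (K₀ * H * ((1 + Cp * (L / c₀)) * ‖g‖) / α) / c₀ := by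
          gcongr
          nlinarith [mul_nonneg hH hL, mul_nonneg hK0 hβ]
      _ = _ := by field_simp
  have hfinal : ‖(uh - umsk).2‖ ≤ ((β + L * Cp) * (K₀ * (1 + K₀) *
      ((β + H * L) * (1 + Cp * (L / c₀)) / (c₀ * α)) * ‖g‖ * H) +
      (Real.sqrt β + (Real.sqrt α)⁻¹ * (L * Cp)) * m) / c₀ := by
    rw [le_div_iff₀ hc, mul_comm]
    refine (herr₂.trans hmid).trans ?_
    gcongr
  refine hfinal.trans ?_
  -- Here the stated constants appear: `const₂` is `const₁` times `1 + Cp * (L / c₀)`, the factor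
  -- from the bound of `g - F(u_h)`, and `c₀ ^ 2` collects one `c₀` from each of the two Céa-type
  -- bounds.
  have e : ((β + L * Cp) * (K₀ * (1 + K₀) *
      ((β + H * L) * (1 + Cp * (L / c₀)) / (c₀ * α)) * ‖g‖ * H) +
      (Real.sqrt β + (Real.sqrt α)⁻¹ * (L * Cp)) * m) / c₀ =
      K₀ * (1 + K₀) * (LOD.const₂ α β L₁ L₂ c₀ Cp H * ‖g‖ * H) +
        LOD.const₃ α β L₁ L₂ c₀ Cp * m := by
    rw [LOD.const₂, LOD.const₁, LOD.const₃, ← hLdef]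
    field_simp
  have h2 : 0 ≤ LOD.const₂ α β L₁ L₂ c₀ Cp H * ‖g‖ * H := by
    have : 0 ≤ LOD.const₁ α β L₁ L₂ c₀ Cp H := by
      rw [LOD.const₁, ← hLdef]; positivity
    rw [LOD.const₂, ← hLdef]
    positivity
  have h3 : 0 ≤ LOD.const₃ α β L₁ L₂ c₀ Cp * m := by
    rw [LOD.const₃, ← hLdef]; positivity
  rw [e]
  nlinarith [mul_nonneg (mul_nonneg hK0 (by positivity : 0 ≤ 1 + K₀)) h3]
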